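/- Let $n \ge 1$ be an integer and let $\mathcal{C}$ be an additive and idempotent complete category. A right (resp. left) $\mathcal{C}$-module is a contravariant (resp. covariant) additive functor from $\mathcal{C}$ to abelian groups; exactness of sequences of modules is meant objectwise. A right module $F$ is finitely presented if there is an exact sequence $\mathcal{C}(-,X)\xrightarrow{\mathcal{C}(-,f)}\mathcal{C}(-,Y)\to F\to 0$ for some morphism $f:X\to Y$ in $\mathcal{C}$; a left module $G$ is finitely presented if there is an exact sequence $\mathcal{C}(Y,-)\xrightarrow{\mathcal{C}(f,-)}\mathcal{C}(X,-)\to G\to 0$ for some $f:X\to Y$. Let $\operatorname{mod}\mathcal{C}$ and $\operatorname{mod}\mathcal{C}^{\mathrm{op}}$ be the categories of finitely presented right and left modules. $\mathcal{C}$ is right (resp. left) coherent if $\operatorname{mod}\mathcal{C}$ (resp. $\operatorname{mod}\mathcal{C}^{\mathrm{op}}$) is abelian. An $n$-kernel of $f:X\to Y$ is a sequence $X_n\to\cdots\to X_1\to X$ in $\mathcal{C}$ such that $0\to\mathcal{C}(-,X_n)\to\cdots\to\mathcal{C}(-,X_1)\to\mathcal{C}(-,X)\to\mathcal{C}(-,Y)$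 is exact; an $n$-cokernel of $f$ is a sequence $Y\to Y_1\to\cdots\to Y_n$ such that $0\to\mathcal{C}(Y_n,-)\to\cdots\to\mathcal{C}(Y_1,-)\to\mathcal{C}(Y,-)\to\mathcal{C}(X,-)$ is exact. $\mathcal{C}$ is $n$-abelian if every morphism has an $n$-kernel and an $n$-cokernel; for every monomorphism $f:X\to Y$ and every $n$-cokernel $Y\xrightarrow{g_1}Y_1\to\cdots\xrightarrow{g_n}Y_n$ of $f$, the sequence $X\xrightarrow{f}Y\xrightarrow{g_1}\cdots\xrightarrow{g_{n-1}}Y_{n-1}$ is an $n$-kernel of $g_n$; and for every epimorphism $f:X\to Y$ and every $n$-kernel $X_n\xrightarrow{f_n}\cdots\xrightarrow{f_1}X$ of $f$, the sequence $X_{n-1}\xrightarrow{f_{n-1}}\cdots\xrightarrow{f_1}X\xrightarrow{f}Y$ is an $n$-cokernel of $f_n$ (with $X_0=X$, $Y_0=Y$). For a finitely presented module $F$ with $F\simeq\operatorname{Coker}\mathcal{C}(-,f)$ (resp. $F\simeq\operatorname{Coker}\mathcal{C}(f,-)$), a transpose $\operatorname{Tr}F$ is $\operatorname{Coker}\mathcal{C}(f,-)$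 (resp. $\operatorname{Coker}\mathcal{C}(-,f)$); it is unique up to projective direct summands. If $\mathcal{C}$ is left coherent, $F\in\operatorname{mod}\mathcal{C}$ is $n$-torsion free if $\operatorname{Ext}^i(\operatorname{Tr}F,\mathcal{C}(X,-))=0$ in $\operatorname{mod}\mathcal{C}^{\mathrm{op}}$ for all $X\in\mathcal{C}$ and $1\le i\le n$. If $\mathcal{C}$ is right coherent, $F\in\operatorname{mod}\mathcal{C}^{\mathrm{op}}$ is $n$-torsion free if $\operatorname{Ext}^i(\operatorname{Tr}F,\mathcal{C}(-,X))=0$ in $\operatorname{mod}\mathcal{C}$ for all $X\in\mathcal{C}$ and $1\le i\le n$. Theorem. $\mathcal{C}$ is $n$-abelian if and only if the following four axioms hold: (F1) $\mathcal{C}$ is right coherent and $\operatorname{gl.dim}(\operatorname{mod}\mathcal{C})\le n+1$; (F1$^{\mathrm{op}}$) $\mathcal{C}$ is left coherent and $\operatorname{gl.dim}(\operatorname{mod}\mathcal{C}^{\mathrm{op}})\le n+1$; (F2) every $F\in\operatorname{mod}\mathcal{C}$ with projective dimension $\le 1$ is $n$-torsion free; (F2$^{\mathrm{op}}$) every $F\in\operatorname{mod}\mathcal{C}^{\mathrm{op}}$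 with projective dimension $\le 1$ is $n$-torsion free. -/

import Mathlib

open CategoryTheory CategoryTheory.Limits Opposite

universe v u

noncomputable section

namespace NAb

/-! ### Abelian categories as a property of preadditive categories, and global dimension -/

/-- The property of a category with a given preadditive structure of being abelian. -/
class IsAbelianCategory (A : Type u) [Category.{v} A] [Preadditive A] : Prop where
  hasFiniteProducts : HasFiniteProducts A
  hasKernels : HasKernels A
  hasCokernels : HasCokernels A
  isNormalMonoCategory : IsNormalMonoCategory A
  isNormalEpiCategory : IsNormalEpiCategory A

/-- The abelian structure, over the given preadditive structure. -/
abbrev IsAbelianCategory.abelian (A : Type u) [Category.{v} A] [P : Preadditive A]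
    [h : IsAbelianCategory A] : Abelian A :=
  { P with
    toIsNormalMonoCategory := h.isNormalMonoCategory
    toIsNormalEpiCategory := h.isNormalEpiCategory
    has_finite_products := h.hasFiniteProducts
    has_kernels := h.hasKernels
    has_cokernels := h.hasCokernels }

/-- The global dimension of an abelian category: the supremum of the projective dimensions of
its objects. -/
def globalDimension (A : Type u) [Category.{v} A] [Abelian A] : WithBot ℕ∞ :=
  ⨆ X : A, projectiveDimension X

section Modules

variable {C : Type u} [Category.{v} C] [Preadditive C]

/-! ### Finitely presented modules

A right module is an additive functor `Cᵒᵖ ⥤ AddCommGrpCat`, a left module is an additive functor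
`C ⥤ AddCommGrpCat`. Exactness of sequences of modules is exactness at each object. -/

/-- There is an exact sequence `C(-, X) ⟶ C(-, Y) ⟶ F ⟶ 0` whose first map is `C(-, f)`;
in other words `F` is a cokernel of `C(-, f)`. -/
def RightPresents {X Y : C} (f : X ⟶ Y) (F : Cᵒᵖ ⥤ AddCommGrpCat.{v}) : Prop :=
  ∃ p : preadditiveYoneda.obj Y ⟶ F, ∀ Z : Cᵒᵖ,
    Function.Exact ((preadditiveYoneda.map f).app Z).hom (p.app Z).hom ∧
      Function.Surjective (p.app Z).hom

/-- There is an exact sequence `C(Y, -) ⟶ C(X, -) ⟶ F ⟶ 0` whose first map is `C(f, -)`;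
in other words `F` is a cokernel of `C(f, -)`. -/
def LeftPresents {X Y : C} (f : X ⟶ Y) (F : C ⥤ AddCommGrpCat.{v}) : Prop :=
  ∃ p : preadditiveCoyoneda.obj (op X) ⟶ F, ∀ Z : C,
    Function.Exact ((preadditiveCoyoneda.map f.op).app Z).hom (p.app Z).hom ∧
      Function.Surjective (p.app Z).hom

variable (C) in
/-- Finitely presented right modules. -/
def isFpRight : ObjectProperty (Cᵒᵖ ⥤ AddCommGrpCat.{v}) := fun F =>
  F.Additive ∧ ∃ (X Y : C) (f : X ⟶ Y), RightPresents f F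

variable (C) in
/-- Finitely presented left modules. -/
def isFpLeft : ObjectProperty (C ⥤ AddCommGrpCat.{v}) := fun F =>
  F.Additive ∧ ∃ (X Y : C) (f : X ⟶ Y), LeftPresents f F

variable (C) in
/-- The category of finitely presented right `C`-modules. -/
abbrev FpRight := (isFpRight C).FullSubcategory

variable (C) in
/-- The category of finitely presented left `C`-modules. -/
abbrev FpLeft := (isFpLeft C).FullSubcategory

lemma isFpRight_yoneda (X : C) : isFpRight C (preadditiveYoneda.obj X) := by
  refine ⟨inferInstance, X, X, 0, 𝟙 _, fun Z => ⟨fun a => ?_, fun a => ⟨a, rfl⟩⟩⟩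
  constructor
  · rintro (rfl : a = 0)
    exact ⟨0, map_zero _⟩
  · rintro ⟨b, rfl⟩
    exact (comp_zero : (show Z.unop ⟶ X from b) ≫ (0 : X ⟶ X) = 0)

lemma isFpLeft_coyoneda (X : C) : isFpLeft C (preadditiveCoyoneda.obj (op X)) := by
  refine ⟨inferInstance, X, X, 0, 𝟙 _, fun Z => ⟨fun a => ?_, fun a => ⟨a, rfl⟩⟩⟩
  constructor
  · rintro (rfl : a = 0)
    exact ⟨0, map_zero _⟩
  · rintro ⟨b, rfl⟩
    exact (zero_comp : (0 : X ⟶ X) ≫ (show X ⟶ Z from b) = 0)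

/-- The representable right module `C(-, X)`. -/
def rightRep (X : C) : FpRight C := ⟨preadditiveYoneda.obj X, isFpRight_yoneda X⟩

/-- The representable left module `C(X, -)`. -/
def leftRep (X : C) : FpLeft C := ⟨preadditiveCoyoneda.obj (op X), isFpLeft_coyoneda X⟩

/-! ### Coherence -/

variable (C) in
/-- `C` is right coherent: the category of finitely presented right modules is abelian. -/
abbrev IsRightCoherent : Prop := IsAbelianCategory (FpRight C)

variable (C) in
/-- `C` is left coherent: the category of finitely presented left modules is abelian. -/
abbrev IsLeftCoherent : Prop := IsAbelianCategory (FpLeft C)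

instance abelianFpRight [IsRightCoherent C] : Abelian (FpRight C) :=
  IsAbelianCategory.abelian (FpRight C)

instance abelianFpLeft [IsLeftCoherent C] : Abelian (FpLeft C) :=
  IsAbelianCategory.abelian (FpLeft C)

/-! ### Transposes and torsion free modules -/

/-- The left module `T` is a transpose of the right module `F`, or, equivalently, `F` is a
transpose of `T`: some morphism `f` of `C` satisfies `F ≅ Coker C(-, f)` and
`T ≅ Coker C(f, -)`. -/
def AreTransposes (F : FpRight C) (T : FpLeft C) : Prop :=
  ∃ (X Y : C) (f : X ⟶ Y), RightPresents f F.obj ∧ LeftPresents f T.obj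

/-- The finitely presented right module `F` is `k`-torsion free: `Ext^i(Tr F, C(X, -)) = 0` for
all `1 ≤ i ≤ k` and all `X`, with `Ext` taken in the category of finitely presented left modules.
As transposes are unique only up to projective summands, all of them are considered. -/
def IsRightTorsionFree [IsLeftCoherent C] (k : ℕ) (F : FpRight C) : Prop :=
  letI := HasExt.standard (FpLeft C)
  ∀ T : FpLeft C, AreTransposes F T → ∀ i : ℕ, 1 ≤ i → i ≤ k → ∀ X : C,
    Subsingleton (Abelian.Ext T (leftRep X) i)

/-- The finitely presented left module `F` is `k`-torsion free: `Ext^i(Tr F, C(-, X)) = 0` for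
all `1 ≤ i ≤ k` and all `X`, with `Ext` taken in the category of finitely presented right
modules. -/
def IsLeftTorsionFree [IsRightCoherent C] (k : ℕ) (F : FpLeft C) : Prop :=
  letI := HasExt.standard (FpRight C)
  ∀ T : FpRight C, AreTransposes T F → ∀ i : ℕ, 1 ≤ i → i ≤ k → ∀ X : C,
    Subsingleton (Abelian.Ext T (rightRep X) i)

/-! ### `n`-kernels, `n`-cokernels and `n`-abelian categories

A sequence `Z : ComposableArrows C (n + 1)` is `Z 0 ⟶ Z 1 ⟶ ⋯ ⟶ Z n ⟶ Z (n + 1)`. -/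

/-- The first `n` morphisms `Z 0 ⟶ ⋯ ⟶ Z n` form an `n`-kernel of the last morphism
`Z n ⟶ Z (n + 1)`: the sequence `0 ⟶ C(-, Z 0) ⟶ ⋯ ⟶ C(-, Z n) ⟶ C(-, Z (n + 1))` is exact. -/
structure InitIsNKernelOfLast {n : ℕ} (Z : ComposableArrows C (n + 1)) : Prop where
  injective (W : C) : Function.Injective fun a : W ⟶ Z.obj' 0 => a ≫ Z.map' 0 1
  exact (i : ℕ) (hi : i < n) (W : C) :
    Function.Exact (fun a : W ⟶ Z.obj' i => a ≫ Z.map' i (i + 1))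
      (fun b : W ⟶ Z.obj' (i + 1) => b ≫ Z.map' (i + 1) (i + 2))

/-- The last `n` morphisms `Z 1 ⟶ ⋯ ⟶ Z (n + 1)` form an `n`-cokernel of the first morphism
`Z 0 ⟶ Z 1`: the sequence `0 ⟶ C(Z (n + 1), -) ⟶ ⋯ ⟶ C(Z 1, -) ⟶ C(Z 0, -)` is exact. -/
structure TailIsNCokernelOfFirst {n : ℕ} (Z : ComposableArrows C (n + 1)) : Prop where
  injective (W : C) : Function.Injective fun a : Z.obj' (n + 1) ⟶ W => Z.map' n (n + 1) ≫ a
  exact (i : ℕ) (hi : i < n) (W : C) :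
    Function.Exact (fun a : Z.obj' (i + 2) ⟶ W => Z.map' (i + 1) (i + 2) ≫ a)
      (fun b : Z.obj' (i + 1) ⟶ W => Z.map' i (i + 1) ≫ b)

variable (C) in
/-- Every morphism has an `n`-kernel. (The last morphism of `Z` is `f` up to an isomorphism of
arrows, along which the ends of `Z` can be replaced.) -/
def HasNKernels (n : ℕ) : Prop :=
  ∀ ⦃X Y : C⦄ (f : X ⟶ Y), ∃ Z : ComposableArrows C (n + 1),
    Nonempty (Arrow.mk (Z.map' n (n + 1)) ≅ Arrow.mk f) ∧ InitIsNKernelOfLast Z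

variable (C) in
/-- Every morphism has an `n`-cokernel. -/
def HasNCokernels (n : ℕ) : Prop :=
  ∀ ⦃X Y : C⦄ (f : X ⟶ Y), ∃ Z : ComposableArrows C (n + 1),
    Nonempty (Arrow.mk (Z.map' 0 1) ≅ Arrow.mk f) ∧ TailIsNCokernelOfFirst Z

variable (C) in
/-- The axioms of an `n`-abelian category, for an additive idempotent complete category `C`. -/
structure IsNAbelian (n : ℕ) : Prop where
  hasNKernels : HasNKernels C n
  hasNCokernels : HasNCokernels C n
  /-- For a monomorphism `Z 0 ⟶ Z 1` with an `n`-cokernel `Z 1 ⟶ ⋯ ⟶ Z (n + 1)`, the sequence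
  `Z 0 ⟶ ⋯ ⟶ Z n` is an `n`-kernel of `Z n ⟶ Z (n + 1)`. -/
  mono (Z : ComposableArrows C (n + 1)) (hZ : Mono (Z.map' 0 1))
    (h : TailIsNCokernelOfFirst Z) : InitIsNKernelOfLast Z
  /-- For an epimorphism `Z n ⟶ Z (n + 1)` with an `n`-kernel `Z 0 ⟶ ⋯ ⟶ Z n`, the sequence
  `Z 1 ⟶ ⋯ ⟶ Z (n + 1)` is an `n`-cokernel of `Z 0 ⟶ Z 1`. -/
  epi (Z : ComposableArrows C (n + 1)) (hZ : Epi (Z.map' n (n + 1)))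
    (h : InitIsNKernelOfLast Z) : TailIsNCokernelOfFirst Z

end Modules

end NAb

end

/-!
Right `C`-modules and left `C`-modules are treated at the same time, as the right `D`-modules for
`D = C` and `D = Cᵒᵖ`.

A sequence `Z 0 ⟶ ⋯ ⟶ Z (n + 1)` is an `n`-kernel of its last morphism `f` iff `Z 0 ⟶ Z 1` is a
monomorphism and each morphism is a weak kernel of the next one, that is, iff its representable
functors form a projective resolution of `Coker D(-, f)` of length `n + 1`. Hence `n`-kernels exist
iff the finitely presented `D`-modules form an abelian category of global dimension at most `n + 1`.

In an `n`-cokernel `Z` of `f` each morphism is a weak cokernel of the previous one, so that `Z`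
induces a projective resolution of the transpose `Coker D(f, -)`. The groups `Ext^i` of the
transpose with values in the representable modules vanish for `1 ≤ i ≤ n` iff each morphism of `Z`
is also a weak kernel of the next one, which for a monomorphism `f` says that `Z` is an `n`-kernel
of its last morphism. The modules `Coker D(-, f)` of projective dimension at most one are those for
which `f` is a split epimorphism followed by a monomorphism, and the split epimorphism is harmless.
-/

namespace NAb

section WeakKernels

universe v₁ u₁

variable {D : Type u₁} [Category.{v₁} D] [HasZeroMorphisms D]

/-- `k` is a weak kernel of `f`: the sequence `D(-, K) ⟶ D(-, X) ⟶ D(-, Y)` is exact. -/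
structure IsWeakKernel {K X Y : D} (k : K ⟶ X) (f : X ⟶ Y) : Prop where
  zero : k ≫ f = 0
  exists_lift {W : D} (a : W ⟶ X) : a ≫ f = 0 → ∃ b : W ⟶ K, b ≫ k = a

/-- `c` is a weak cokernel of `f`: the sequence `D(Q, -) ⟶ D(Y, -) ⟶ D(X, -)` is exact. -/
structure IsWeakCokernel {X Y Q : D} (f : X ⟶ Y) (c : Y ⟶ Q) : Prop where
  zero : f ≫ c = 0
  exists_desc {W : D} (a : Y ⟶ W) : f ≫ a = 0 → ∃ b : Q ⟶ W, c ≫ b = a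

lemma isWeakKernel_op_iff {X Y Q : D} {f : X ⟶ Y} {c : Y ⟶ Q} :
    IsWeakKernel c.op f.op ↔ IsWeakCokernel f c :=
  ⟨fun H => ⟨Quiver.Hom.op_inj H.zero, fun a ha =>
      (H.exists_lift a.op (Quiver.Hom.unop_inj ha)).imp' Quiver.Hom.unop
        fun _ hb => Quiver.Hom.op_inj hb⟩,
    fun H => ⟨Quiver.Hom.unop_inj H.zero, fun a ha =>
      (H.exists_desc a.unop (Quiver.Hom.op_inj ha)).imp' Quiver.Hom.op
        fun _ hb => Quiver.Hom.unop_inj hb⟩⟩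

lemma isWeakCokernel_op_iff {K X Y : D} {k : K ⟶ X} {f : X ⟶ Y} :
    IsWeakCokernel f.op k.op ↔ IsWeakKernel k f :=
  ⟨fun H => ⟨Quiver.Hom.op_inj H.zero, fun a ha =>
      (H.exists_desc a.op (Quiver.Hom.unop_inj ha)).imp' Quiver.Hom.unop
        fun _ hb => Quiver.Hom.op_inj hb⟩,
    fun H => ⟨Quiver.Hom.unop_inj H.zero, fun a ha =>
      (H.exists_lift a.unop (Quiver.Hom.op_inj ha)).imp' Quiver.Hom.op
        fun _ hb => Quiver.Hom.unop_inj hb⟩⟩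

lemma IsWeakKernel.hasWeakKernel {K X Y : D} {k : K ⟶ X} {f : X ⟶ Y} (hk : IsWeakKernel k f) :
    HasWeakKernel f :=
  HasWeakLimit.mk ⟨KernelFork.ofι k hk.zero, Fork.IsWeakLimit.mk _
    (fun s => (hk.exists_lift s.ι (KernelFork.condition s)).choose)
    fun s => (hk.exists_lift s.ι (KernelFork.condition s)).choose_spec⟩

lemma exists_isWeakKernel {X Y : D} (f : X ⟶ Y) [HasWeakKernel f] :
    ∃ (K : D) (k : K ⟶ X), IsWeakKernel k f :=
  ⟨_, weakKernel.ι f, weakKernel.condition f,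
    fun a ha => ⟨weakKernel.lift f a ha, weakKernel.lift_ι f a ha⟩⟩

lemma IsWeakKernel.of_arrow_iso {K X Y X' Y' : D} {k : K ⟶ X} {f : X ⟶ Y} {f' : X' ⟶ Y'}
    (hk : IsWeakKernel k f) (e : Arrow.mk f ≅ Arrow.mk f') : IsWeakKernel (k ≫ e.hom.left) f' := by
  have h₁ : e.hom.left ≫ f' = f ≫ e.hom.right := e.hom.w
  have h₂ : e.inv.left ≫ f = f' ≫ e.inv.right := e.inv.w
  refine ⟨by rw [Category.assoc, h₁, reassoc_of% hk.zero, zero_comp], fun a ha => ?_⟩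
  obtain ⟨b, hb⟩ := hk.exists_lift (a ≫ e.inv.left) (by
    rw [Category.assoc, h₂, reassoc_of% ha, zero_comp])
  exact ⟨b, by rw [reassoc_of% hb, Arrow.inv_hom_id_left]; exact Category.comp_id a⟩

lemma isWeakKernel_splitEpi_comp_iff {K' K X Y : D} {s : K' ⟶ K} [IsSplitEpi s] {k : K ⟶ X}
    {f : X ⟶ Y} : IsWeakKernel (s ≫ k) f ↔ IsWeakKernel k f := by
  refine ⟨fun H => ⟨(cancel_epi s).1 ?_, fun a ha => ?_⟩, fun H => ⟨?_, fun a ha => ?_⟩⟩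
  · rw [← Category.assoc, H.zero, comp_zero]
  · obtain ⟨b, rfl⟩ := H.exists_lift a ha
    exact ⟨b ≫ s, Category.assoc _ _ _⟩
  · rw [Category.assoc, H.zero, comp_zero]
  · obtain ⟨b, rfl⟩ := H.exists_lift a ha
    exact ⟨b ≫ section_ s, by rw [Category.assoc, IsSplitEpi.id_assoc]⟩

lemma isWeakCokernel_epi_comp_iff {X' X Y Q : D} {s : X' ⟶ X} [Epi s] {f : X ⟶ Y} {c : Y ⟶ Q} :
    IsWeakCokernel (s ≫ f) c ↔ IsWeakCokernel f c := by
  have comp_eq_zero_iff {W : D} (a : Y ⟶ W) : (s ≫ f) ≫ a = 0 ↔ f ≫ a = 0 := by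
    rw [Category.assoc, ← cancel_epi s, comp_zero]
  exact ⟨fun H => ⟨(comp_eq_zero_iff c).1 H.zero, fun a ha =>
      H.exists_desc a ((comp_eq_zero_iff a).2 ha)⟩,
    fun H => ⟨(comp_eq_zero_iff c).2 H.zero, fun a ha =>
      H.exists_desc a ((comp_eq_zero_iff a).1 ha)⟩⟩

end WeakKernels

section Sequences

universe v₁ u₁

lemma map_eq_eqToHom_comp_map {J E : Type*} [Category* J] [Quiver.IsThin J] [Category* E]
    (W : J ⥤ E) {i i' j j' : J} (hi : i' = i) (hj : j' = j) (u : i ⟶ j) (u' : i' ⟶ j') :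
    W.map u' = eqToHom (congrArg W.obj hi) ≫ W.map u ≫ eqToHom (congrArg W.obj hj.symm) := by
  subst hi hj
  rw [eqToHom_refl, eqToHom_refl, Category.id_comp, Category.comp_id, Subsingleton.elim u' u]

variable {D : Type u₁} [Category.{v₁} D]

/-- The sequence `Z` read backwards in the opposite category. -/
noncomputable def opSeq {m : ℕ} (Z : ComposableArrows D m) : ComposableArrows Dᵒᵖ m :=
  (ComposableArrows.opEquivalence D m).functor.obj (op Z)

lemma opSeq_surjective (m : ℕ) :
    Function.Surjective (opSeq : ComposableArrows D m → ComposableArrows Dᵒᵖ m) := fun W =>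
  ⟨((ComposableArrows.opEquivalence D m).inverse.obj W).unop,
    CategoryTheory.Functor.ext (fun i => congrArg W.obj (Fin.rev_rev i)) fun i j u =>
      map_eq_eqToHom_comp_map W (Fin.rev_rev i) (Fin.rev_rev j) u _⟩

lemma mono_opSeq_map'_iff {m : ℕ} (Z : ComposableArrows D m) {i j i' j' : ℕ} (hij : i ≤ j)
    (hj : j ≤ m) (hi' : i + j' = m) (hj' : j + i' = m) :
    Mono ((opSeq Z).map' i j) ↔ Epi (Z.map' i' j') := by
  obtain rfl : j' = m + 1 - (i + 1) := by lia
  obtain rfl : i' = m + 1 - (j + 1) := by lia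
  exact op_mono_iff _

lemma epi_opSeq_map'_iff {m : ℕ} (Z : ComposableArrows D m) {i j i' j' : ℕ} (hij : i ≤ j)
    (hj : j ≤ m) (hi' : i + j' = m) (hj' : j + i' = m) :
    Epi ((opSeq Z).map' i j) ↔ Mono (Z.map' i' j') := by
  obtain rfl : j' = m + 1 - (i + 1) := by lia
  obtain rfl : i' = m + 1 - (j + 1) := by lia
  exact op_epi_iff _

lemma nonempty_arrow_op_iso_iff {X Y X' Y' : D} {f : X ⟶ Y} {f' : X' ⟶ Y'} :
    Nonempty (Arrow.mk f.op ≅ Arrow.mk f'.op) ↔ Nonempty (Arrow.mk f ≅ Arrow.mk f') :=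
  ⟨fun ⟨e⟩ => ⟨Arrow.isoMk (Arrow.rightFunc.mapIso e).unop.symm (Arrow.leftFunc.mapIso e).unop.symm
      (Quiver.Hom.op_inj e.inv.w.symm)⟩,
    fun ⟨e⟩ => ⟨Arrow.isoMk (Arrow.rightFunc.mapIso e).op.symm (Arrow.leftFunc.mapIso e).op.symm
      (Quiver.Hom.unop_inj e.inv.w.symm)⟩⟩

lemma nonempty_arrow_opSeq_iso_iff {m : ℕ} (Z : ComposableArrows D m) {i j i' j' : ℕ} (hij : i ≤ j)
    (hj : j ≤ m) (hi' : i + j' = m) (hj' : j + i' = m) {X Y : D} (f : X ⟶ Y) :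
    Nonempty (Arrow.mk ((opSeq Z).map' i j) ≅ Arrow.mk f.op) ↔
      Nonempty (Arrow.mk (Z.map' i' j') ≅ Arrow.mk f) := by
  obtain rfl : j' = m + 1 - (i + 1) := by lia
  obtain rfl : i' = m + 1 - (j + 1) := by lia
  exact nonempty_arrow_op_iso_iff

section ZeroMorphisms

variable [HasZeroMorphisms D]

/-- Every morphism of the sequence `Z` but the last is a weak kernel of the next one. -/
def IsWeakKernelSequence {m : ℕ} (Z : ComposableArrows D m) : Prop :=
  ∀ (i : ℕ) (_ : i + 1 < m), IsWeakKernel (Z.map' i (i + 1)) (Z.map' (i + 1) (i + 2))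

/-- Every morphism of the sequence `Z` but the first is a weak cokernel of the previous one. -/
def IsWeakCokernelSequence {m : ℕ} (Z : ComposableArrows D m) : Prop :=
  ∀ (i : ℕ) (_ : i + 1 < m), IsWeakCokernel (Z.map' i (i + 1)) (Z.map' (i + 1) (i + 2))

lemma isWeakKernelSequence_precomp_iff {m : ℕ} {Z : ComposableArrows D (m + 1)} {K : D}
    {k : K ⟶ Z.left} : IsWeakKernelSequence (Z.precomp k) ↔
      IsWeakKernel k (Z.map' 0 1) ∧ IsWeakKernelSequence Z := by
  refine ⟨fun H => ⟨H 0 (by lia), fun i _ => H (i + 1) (by lia)⟩, fun ⟨hk, H⟩ => ?_⟩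
  rintro (_ | i) hi
  exacts [hk, H i (by lia)]

lemma isWeakCokernelSequence_precomp_iff {m : ℕ} {Z : ComposableArrows D (m + 1)} {K : D}
    {k : K ⟶ Z.left} : IsWeakCokernelSequence (Z.precomp k) ↔
      IsWeakCokernel k (Z.map' 0 1) ∧ IsWeakCokernelSequence Z := by
  refine ⟨fun H => ⟨H 0 (by lia), fun i _ => H (i + 1) (by lia)⟩, fun ⟨hk, H⟩ => ?_⟩
  rintro (_ | i) hi
  exacts [hk, H i (by lia)]

lemma isWeakKernel_opSeq_iff {m : ℕ} (Z : ComposableArrows D m) {i j k i' j' k' : ℕ} (hij : i ≤ j)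
    (hjk : j ≤ k) (hik' : i + k' = m) (hjj' : j + j' = m) (hki' : k + i' = m) :
    IsWeakKernel ((opSeq Z).map' i j) ((opSeq Z).map' j k) ↔
      IsWeakCokernel (Z.map' i' j') (Z.map' j' k') := by
  obtain rfl : k' = m + 1 - (i + 1) := by lia
  obtain rfl : j' = m + 1 - (j + 1) := by lia
  obtain rfl : i' = m + 1 - (k + 1) := by lia
  exact isWeakKernel_op_iff

lemma isWeakCokernel_opSeq_iff {m : ℕ} (Z : ComposableArrows D m) {i j k i' j' k' : ℕ} (hij : i ≤ j)
    (hjk : j ≤ k) (hik' : i + k' = m) (hjj' : j + j' = m) (hki' : k + i' = m) :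
    IsWeakCokernel ((opSeq Z).map' i j) ((opSeq Z).map' j k) ↔
      IsWeakKernel (Z.map' i' j') (Z.map' j' k') := by
  obtain rfl : k' = m + 1 - (i + 1) := by lia
  obtain rfl : j' = m + 1 - (j + 1) := by lia
  obtain rfl : i' = m + 1 - (k + 1) := by lia
  exact isWeakCokernel_op_iff

lemma isWeakKernelSequence_opSeq_iff {m : ℕ} {Z : ComposableArrows D m} :
    IsWeakKernelSequence (opSeq Z) ↔ IsWeakCokernelSequence Z := by
  constructor
  · intro H i hi
    obtain ⟨j, rfl⟩ := Nat.exists_eq_add_of_le hi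
    exact (isWeakKernel_opSeq_iff Z _ _ (by lia) (by lia) (by lia)).1 (H j (by lia))
  · intro H i hi
    obtain ⟨j, rfl⟩ := Nat.exists_eq_add_of_le hi
    exact (isWeakKernel_opSeq_iff Z _ _ (by lia) (by lia) (by lia)).2 (H j (by lia))

lemma isWeakCokernelSequence_opSeq_iff {m : ℕ} {Z : ComposableArrows D m} :
    IsWeakCokernelSequence (opSeq Z) ↔ IsWeakKernelSequence Z := by
  constructor
  · intro H i hi
    obtain ⟨j, rfl⟩ := Nat.exists_eq_add_of_le hi
    exact (isWeakCokernel_opSeq_iff Z _ _ (by lia) (by lia) (by lia)).1 (H j (by lia))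
  · intro H i hi
    obtain ⟨j, rfl⟩ := Nat.exists_eq_add_of_le hi
    exact (isWeakCokernel_opSeq_iff Z _ _ (by lia) (by lia) (by lia)).2 (H j (by lia))

end ZeroMorphisms

end Sequences

section NKernels

universe v₁ u₁

variable {D : Type u₁} [Category.{v₁} D] [Preadditive D]

lemma initIsNKernelOfLast_iff {n : ℕ} {Z : ComposableArrows D (n + 1)} :
    InitIsNKernelOfLast Z ↔ Mono (Z.map' 0 1) ∧ IsWeakKernelSequence Z := by
  constructor
  · intro hZ
    exact ⟨⟨fun a b hab => hZ.injective _ hab⟩, fun i hi =>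
      ⟨(hZ.exact i (by lia) _ _).2 ⟨𝟙 _, Category.id_comp _⟩,
        fun a => (hZ.exact i (by lia) _ a).1⟩⟩
  · rintro ⟨_, hZ⟩
    refine ⟨fun W a b hab => (cancel_mono _).1 hab, fun i hi W a =>
      ⟨(hZ i (by lia)).exists_lift a, ?_⟩⟩
    rintro ⟨b, rfl⟩
    exact (Category.assoc _ _ _).trans ((congrArg (b ≫ ·) (hZ i (by lia)).zero).trans comp_zero)

lemma tailIsNCokernelOfFirst_iff {n : ℕ} {Z : ComposableArrows D (n + 1)} :
    TailIsNCokernelOfFirst Z ↔ Epi (Z.map' n (n + 1)) ∧ IsWeakCokernelSequence Z := by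
  constructor
  · intro hZ
    exact ⟨⟨fun a b hab => hZ.injective _ hab⟩, fun i hi =>
      ⟨(hZ.exact i (by lia) _ _).2 ⟨𝟙 _, Category.comp_id _⟩,
        fun a => (hZ.exact i (by lia) _ a).1⟩⟩
  · rintro ⟨_, hZ⟩
    refine ⟨fun W a b hab => (cancel_epi _).1 hab, fun i hi W a =>
      ⟨(hZ i (by lia)).exists_desc a, ?_⟩⟩
    rintro ⟨b, rfl⟩
    exact (Category.assoc _ _ _).symm.trans
      ((congrArg (· ≫ b) (hZ i (by lia)).zero).trans zero_comp)

lemma initIsNKernelOfLast_opSeq_iff {n : ℕ} {Z : ComposableArrows D (n + 1)} :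
    InitIsNKernelOfLast (opSeq Z) ↔ TailIsNCokernelOfFirst Z := by
  rw [initIsNKernelOfLast_iff, tailIsNCokernelOfFirst_iff, isWeakKernelSequence_opSeq_iff,
    mono_opSeq_map'_iff Z _ _ (j' := n + 1) (i' := n) (by lia) (by lia)]

lemma tailIsNCokernelOfFirst_opSeq_iff {n : ℕ} {Z : ComposableArrows D (n + 1)} :
    TailIsNCokernelOfFirst (opSeq Z) ↔ InitIsNKernelOfLast Z := by
  rw [initIsNKernelOfLast_iff, tailIsNCokernelOfFirst_iff, isWeakCokernelSequence_opSeq_iff,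
    epi_opSeq_map'_iff Z _ _ (j' := 1) (i' := 0) (by lia) (by lia)]

lemma hasNKernels_op_iff {n : ℕ} : HasNKernels Dᵒᵖ n ↔ HasNCokernels D n := by
  constructor
  · intro H X Y f
    obtain ⟨W, hWf, hW⟩ := H f.op
    obtain ⟨Z, rfl⟩ := opSeq_surjective _ W
    exact ⟨Z, (nonempty_arrow_opSeq_iso_iff Z _ _ (by lia) (by lia) f).1 hWf,
      initIsNKernelOfLast_opSeq_iff.1 hW⟩
  · intro H X Y f
    obtain ⟨Z, hZf, hZ⟩ := H f.unop
    exact ⟨opSeq Z, (nonempty_arrow_opSeq_iso_iff Z _ _ (by lia) (by lia) f.unop).2 hZf,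
      initIsNKernelOfLast_opSeq_iff.2 hZ⟩

lemma hasNCokernels_op_iff {n : ℕ} : HasNCokernels Dᵒᵖ n ↔ HasNKernels D n := by
  constructor
  · intro H X Y f
    obtain ⟨W, hWf, hW⟩ := H f.op
    obtain ⟨Z, rfl⟩ := opSeq_surjective _ W
    exact ⟨Z, (nonempty_arrow_opSeq_iso_iff Z _ _ (by lia) (by lia) f).1 hWf,
      tailIsNCokernelOfFirst_opSeq_iff.1 hW⟩
  · intro H X Y f
    obtain ⟨Z, hZf, hZ⟩ := H f.unop
    exact ⟨opSeq Z, (nonempty_arrow_opSeq_iso_iff Z _ _ (by lia) (by lia) f.unop).2 hZf,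
      tailIsNCokernelOfFirst_opSeq_iff.2 hZ⟩

variable (D) in
/-- Every monomorphism is the `n`-kernel of the last morphism of each of its `n`-cokernels: the
third condition on an `n`-abelian category. The fourth one is the same property of `Dᵒᵖ`. -/
def MonosAreNKernels (n : ℕ) : Prop :=
  ∀ Z : ComposableArrows D (n + 1), Mono (Z.map' 0 1) → TailIsNCokernelOfFirst Z →
    InitIsNKernelOfLast Z

lemma monosAreNKernels_op_iff {n : ℕ} : MonosAreNKernels Dᵒᵖ n ↔
    ∀ Z : ComposableArrows D (n + 1), Epi (Z.map' n (n + 1)) → InitIsNKernelOfLast Z →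
      TailIsNCokernelOfFirst Z := by
  refine (opSeq_surjective (n + 1)).forall.trans (forall_congr' fun Z => ?_)
  rw [mono_opSeq_map'_iff Z _ _ (j' := n + 1) (i' := n) (by lia) (by lia),
    tailIsNCokernelOfFirst_opSeq_iff, initIsNKernelOfLast_opSeq_iff]

lemma isNAbelian_iff {n : ℕ} : IsNAbelian D n ↔
    (HasNKernels D n ∧ HasNKernels Dᵒᵖ n) ∧ MonosAreNKernels D n ∧ MonosAreNKernels Dᵒᵖ n := by
  rw [hasNKernels_op_iff, monosAreNKernels_op_iff]
  exact ⟨fun H => ⟨⟨H.hasNKernels, H.hasNCokernels⟩, H.mono, H.epi⟩,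
    fun ⟨⟨h₁, h₂⟩, h₃, h₄⟩ => ⟨h₁, h₂, h₃, h₄⟩⟩

end NKernels

section Presentations

universe v₁ u₁ v₂ u₂

variable {D : Type u₁} [Category.{v₁} D] {A : Type u₂} [Category.{v₂} A] [Preadditive A]

/-- The morphism `p` is a projective presentation of `F` with relations `f`: the sequence
`h X ⟶ h Y ⟶ F ⟶ 0` becomes exact after applying `Hom(h Z, -)` for all `Z`. -/
structure Presents (h : D ⥤ A) {X Y : D} (f : X ⟶ Y) {F : A} (p : h.obj Y ⟶ F) : Prop where
  comp_eq_zero_iff {Z : D} (a : Z ⟶ Y) : h.map a ≫ p = 0 ↔ ∃ b : Z ⟶ X, b ≫ f = a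
  exists_lift {Z : D} (x : h.obj Z ⟶ F) : ∃ a : Z ⟶ Y, h.map a ≫ p = x

/-- Every morphism from an object `h Z` lifts along `e`: the map of modules `e` is objectwise
surjective. -/
def RepSurjective (h : D ⥤ A) {F G : A} (e : F ⟶ G) : Prop :=
  ∀ ⦃Z : D⦄ (x : h.obj Z ⟶ G), ∃ y : h.obj Z ⟶ F, y ≫ e = x

/-- The sequence given by `u` and `w` becomes exact after applying `Hom(h Z, -)` for all `Z`: it is
an objectwise exact sequence of modules. -/
structure RepExact (h : D ⥤ A) {F G H : A} (u : F ⟶ G) (w : G ⟶ H) : Prop where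
  zero : u ≫ w = 0
  exists_lift ⦃Z : D⦄ (x : h.obj Z ⟶ G) : x ≫ w = 0 → ∃ y : h.obj Z ⟶ F, y ≫ u = x

variable {h : D ⥤ A}

lemma Presents.zero {X Y : D} {f : X ⟶ Y} {F : A} {p : h.obj Y ⟶ F} (hp : Presents h f p) :
    h.map f ≫ p = 0 :=
  (hp.comp_eq_zero_iff f).2 ⟨𝟙 X, Category.id_comp f⟩

lemma Presents.of_arrow_iso {X Y X' Y' : D} {f : X ⟶ Y} {f' : X' ⟶ Y'} {F : A}
    {p : h.obj Y ⟶ F} (hp : Presents h f p) (e : Arrow.mk f ≅ Arrow.mk f') :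
    Presents h f' (h.map e.inv.right ≫ p) := by
  have h₁ : e.hom.left ≫ f' = f ≫ e.hom.right := e.hom.w
  have h₂ : e.inv.left ≫ f = f' ≫ e.inv.right := e.inv.w
  have h₃ : e.inv.right ≫ e.hom.right = 𝟙 Y' := Arrow.inv_hom_id_right e
  have h₄ : e.hom.right ≫ e.inv.right = 𝟙 Y := Arrow.hom_inv_id_right e
  refine ⟨fun a => ?_, fun x => ?_⟩
  · rw [← h.map_comp_assoc, hp.comp_eq_zero_iff]
    constructor
    · rintro ⟨b, hb⟩
      exact ⟨b ≫ e.hom.left, by rw [Category.assoc, h₁, reassoc_of% hb, h₃, Category.comp_id]⟩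
    · rintro ⟨b, rfl⟩
      exact ⟨b ≫ e.inv.left, by rw [Category.assoc, h₂, Category.assoc]⟩
  · obtain ⟨a, rfl⟩ := hp.exists_lift x
    exact ⟨a ≫ e.hom.right, by rw [← h.map_comp_assoc, Category.assoc, h₄, Category.comp_id]⟩

lemma Presents.repExact [h.Full] {X Y : D} {f : X ⟶ Y} {F : A} {p : h.obj Y ⟶ F}
    (hp : Presents h f p) : RepExact h (h.map f) p where
  zero := hp.zero
  exists_lift Z x hx := by
    obtain ⟨a, rfl⟩ := h.map_surjective x
    obtain ⟨b, rfl⟩ := (hp.comp_eq_zero_iff a).1 hx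
    exact ⟨h.map b, (h.map_comp b f).symm⟩

lemma isWeakKernel_of_repExact [HasZeroMorphisms D] [h.Full] [h.Faithful]
    [h.PreservesZeroMorphisms] {K X Y : D} {k : K ⟶ X} {f : X ⟶ Y}
    (hkf : RepExact h (h.map k) (h.map f)) : IsWeakKernel k f where
  zero := h.map_injective (by rw [h.map_comp, hkf.zero, h.map_zero])
  exists_lift a ha := by
    obtain ⟨y, hy⟩ := hkf.exists_lift (h.map a) (by rw [← h.map_comp, ha, h.map_zero])
    obtain ⟨b, rfl⟩ := h.map_surjective y
    exact ⟨b, h.map_injective (by rw [h.map_comp, hy])⟩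

variable [Preadditive D]

/-- A fully faithful additive functor `h : D ⥤ A` identifying `A` with the category of finitely
presented right `D`-modules, and `h` with the Yoneda embedding. Left and right modules over `C` are
thus treated at the same time, as `D = Cᵒᵖ` and `D = C`. -/
class IsPresentationFunctor (h : D ⥤ A) : Prop extends h.Full, h.Faithful, h.Additive where
  exists_presentation (F : A) : ∃ (X Y : D) (f : X ⟶ Y) (p : h.obj Y ⟶ F), Presents h f p
  exists_presented {X Y : D} (f : X ⟶ Y) : ∃ (F : A) (p : h.obj Y ⟶ F), Presents h f p
  epi {X Y : D} {f : X ⟶ Y} {F : A} {p : h.obj Y ⟶ F} : Presents h f p → Epi p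
  exists_desc {X Y : D} {f : X ⟶ Y} {F : A} {p : h.obj Y ⟶ F} : Presents h f p →
    ∀ {G : A} (q : h.obj Y ⟶ G), h.map f ≫ q = 0 → ∃ r : F ⟶ G, p ≫ r = q

variable [IsPresentationFunctor h]

lemma Presents.epi {X Y : D} {f : X ⟶ Y} {F : A} {p : h.obj Y ⟶ F} (hp : Presents h f p) :
    Epi p := IsPresentationFunctor.epi hp

lemma Presents.exists_desc {X Y : D} {f : X ⟶ Y} {F : A} {p : h.obj Y ⟶ F} (hp : Presents h f p)
    {G : A} (q : h.obj Y ⟶ G) (hq : h.map f ≫ q = 0) : ∃ r : F ⟶ G, p ≫ r = q :=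
  IsPresentationFunctor.exists_desc hp q hq

lemma Presents.hom_ext {X Y : D} {f : X ⟶ Y} {F : A} {p : h.obj Y ⟶ F} (hp : Presents h f p)
    {G : A} {a b : F ⟶ G} (hab : p ≫ a = p ≫ b) : a = b :=
  have := hp.epi
  (cancel_epi p).1 hab

lemma Presents.exists_map {X Y X' Y' : D} {f : X ⟶ Y} {f' : X' ⟶ Y'} {F F' : A}
    {p : h.obj Y ⟶ F} {p' : h.obj Y' ⟶ F'} (hp : Presents h f p) (hp' : Presents h f' p')
    (a : X ⟶ X') (b : Y ⟶ Y') (hab : a ≫ f' = f ≫ b) : ∃ φ : F ⟶ F', p ≫ φ = h.map b ≫ p' :=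
  hp.exists_desc _ (by
    rw [← h.map_comp_assoc, ← hab, h.map_comp, Category.assoc, hp'.zero, comp_zero])

variable (h) in
lemma hom_ext_of_rep {F G : A} {a b : F ⟶ G}
    (hab : ∀ ⦃Z : D⦄ (x : h.obj Z ⟶ F), x ≫ a = x ≫ b) : a = b := by
  obtain ⟨X, Y, f, p, hp⟩ := IsPresentationFunctor.exists_presentation (h := h) F
  exact hp.hom_ext (hab p)

variable (h) in
lemma mono_of_rep {F G : A} {m : F ⟶ G} (hm : ∀ ⦃Z : D⦄ (x : h.obj Z ⟶ F), x ≫ m = 0 → x = 0) :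
    Mono m :=
  Preadditive.mono_of_cancel_zero _ fun g hg => hom_ext_of_rep h fun Z x => by
    rw [comp_zero, hm (x ≫ g) (by rw [Category.assoc, hg, comp_zero])]

lemma RepSurjective.epi {F G : A} {e : F ⟶ G} (he : RepSurjective h e) : Epi e := by
  refine Preadditive.epi_of_cancel_zero _ fun g hg => hom_ext_of_rep h fun Z x => ?_
  obtain ⟨y, rfl⟩ := he x
  rw [Category.assoc, hg, comp_zero, comp_zero]

lemma RepExact.exists_lift_of_mono {F G H : A} {u : F ⟶ G} {w : G ⟶ H} [Mono u]
    (huw : RepExact h u w) {T : A} (t : T ⟶ G) (ht : t ≫ w = 0) : ∃ l : T ⟶ F, l ≫ u = t := by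
  obtain ⟨X, Y, f, p, hp⟩ := IsPresentationFunctor.exists_presentation (h := h) T
  obtain ⟨l, hl⟩ := huw.exists_lift (p ≫ t) (by rw [Category.assoc, ht, comp_zero])
  obtain ⟨r, hr⟩ := hp.exists_desc l ((cancel_mono u).1 (by
    rw [Category.assoc, hl, reassoc_of% hp.zero, zero_comp, zero_comp]))
  exact ⟨r, hp.hom_ext (by rw [reassoc_of% hr, hl])⟩

lemma RepExact.nonempty_isLimit {F G H : A} {u : F ⟶ G} {w : G ⟶ H} [Mono u]
    (huw : RepExact h u w) : Nonempty (IsLimit (KernelFork.ofι u huw.zero)) := by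
  choose l hl using fun {T : A} => huw.exists_lift_of_mono (T := T)
  exact ⟨KernelFork.IsLimit.ofι _ _ l hl fun t ht _ hm =>
    (cancel_mono u).1 (hm.trans (hl t ht).symm)⟩

lemma RepExact.exists_desc_of_repSurjective {F G H : A} {u : F ⟶ G} {w : G ⟶ H}
    (huw : RepExact h u w) (hw : RepSurjective h w) {T : A} (t : G ⟶ T) (ht : u ≫ t = 0) :
    ∃ l : H ⟶ T, w ≫ l = t := by
  obtain ⟨X, Y, f, p, hp⟩ := IsPresentationFunctor.exists_presentation (h := h) H
  obtain ⟨c, hc⟩ := hw p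
  have comp_eq_zero ⦃Z : D⦄ (x : h.obj Z ⟶ G) (hx : x ≫ w = 0) : x ≫ t = 0 := by
    obtain ⟨y, rfl⟩ := huw.exists_lift x hx
    rw [Category.assoc, ht, comp_zero]
  obtain ⟨r, hr⟩ := hp.exists_desc (c ≫ t) (by
    rw [← Category.assoc]
    exact comp_eq_zero _ (by rw [Category.assoc, hc, hp.zero]))
  refine ⟨r, hom_ext_of_rep h fun Z x => ?_⟩
  obtain ⟨a, ha⟩ := hp.exists_lift (x ≫ w)
  have hx : (x - h.map a ≫ c) ≫ t = 0 :=
    comp_eq_zero _ (by rw [Preadditive.sub_comp, Category.assoc, hc, ha, sub_self])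
  rw [Preadditive.sub_comp, sub_eq_zero, Category.assoc] at hx
  rw [hx, ← reassoc_of% ha, hr]

lemma RepExact.nonempty_isColimit {F G H : A} {u : F ⟶ G} {w : G ⟶ H}
    (huw : RepExact h u w) (hw : RepSurjective h w) :
    Nonempty (IsColimit (CokernelCofork.ofπ w huw.zero)) := by
  have := hw.epi
  choose l hl using fun {T : A} => huw.exists_desc_of_repSurjective hw (T := T)
  exact ⟨CokernelCofork.IsColimit.ofπ _ _ l hl fun t ht _ hm =>
    (cancel_epi w).1 (hm.trans (hl t ht).symm)⟩

section Biproducts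

variable [HasBinaryBiproducts D]

variable (h) in
lemma exists_repExact_repSurjective {F G : A} (φ : F ⟶ G) :
    ∃ (H : A) (π : G ⟶ H), RepExact h φ π ∧ RepSurjective h π := by
  obtain ⟨X', Y', f, p, hp⟩ := IsPresentationFunctor.exists_presentation (h := h) F
  obtain ⟨X, Y, g, q, hq⟩ := IsPresentationFunctor.exists_presentation (h := h) G
  obtain ⟨a, ha⟩ := hq.exists_lift (p ≫ φ)
  obtain ⟨H, r, hr⟩ := IsPresentationFunctor.exists_presented (h := h) (biprod.desc g a)
  have hgr : h.map g ≫ r = 0 := (hr.comp_eq_zero_iff g).2 ⟨biprod.inl, by simp⟩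
  have har : h.map a ≫ r = 0 := (hr.comp_eq_zero_iff a).2 ⟨biprod.inr, by simp⟩
  obtain ⟨π, hπ⟩ := hq.exists_desc r hgr
  refine ⟨H, π, ⟨hp.hom_ext ?_, fun Z x hx => ?_⟩, fun Z x => ?_⟩
  · rw [comp_zero, ← reassoc_of% ha, hπ, har]
  · obtain ⟨y, rfl⟩ := hq.exists_lift x
    rw [Category.assoc, hπ] at hx
    obtain ⟨b, rfl⟩ := (hr.comp_eq_zero_iff y).1 hx
    refine ⟨h.map (b ≫ biprod.snd) ≫ p, ?_⟩
    have hb : b ≫ biprod.desc g a = (b ≫ biprod.fst) ≫ g + (b ≫ biprod.snd) ≫ a := by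
      rw [biprod.desc_eq]; simp
    rw [hb, h.map_add, Preadditive.add_comp, (hq.comp_eq_zero_iff _).2 ⟨_, rfl⟩, zero_add,
      h.map_comp _ a, Category.assoc, Category.assoc, ha]
  · obtain ⟨y, rfl⟩ := hr.exists_lift x
    exact ⟨h.map y ≫ q, by rw [Category.assoc, hπ]⟩

variable (h) in
lemma repSurjective_of_epi {F G : A} (e : F ⟶ G) [Epi e] : RepSurjective h e := by
  obtain ⟨H, π, hπ, -⟩ := exists_repExact_repSurjective h e
  have hπ₀ : π = 0 := (cancel_epi e).1 (by rw [hπ.zero, comp_zero])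
  exact fun Z x => hπ.exists_lift x (by rw [hπ₀, comp_zero])

variable (h) in
lemma projective_obj (X : D) : Projective (h.obj X) where
  factors x e _ := repSurjective_of_epi h e x

variable (h) in
lemma exists_repExact_obj [HasWeakKernels D] {F G : A} (φ : F ⟶ G) :
    ∃ (K : D) (k : h.obj K ⟶ F), RepExact h k φ := by
  obtain ⟨X', Y', f, p, hp⟩ := IsPresentationFunctor.exists_presentation (h := h) F
  obtain ⟨X, Y, g, q, hq⟩ := IsPresentationFunctor.exists_presentation (h := h) G
  obtain ⟨a, ha⟩ := hq.exists_lift (p ≫ φ)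
  -- A weak kernel of `a - g : Y' ⊞ X ⟶ Y` is a weak pullback of `a` and `g`.
  obtain ⟨W, k, hk⟩ := exists_isWeakKernel (biprod.desc a (-g))
  have hk' : (k ≫ biprod.snd) ≫ g = (k ≫ biprod.fst) ≫ a := by
    have := hk.zero
    rw [biprod.desc_eq, Preadditive.comp_add, Preadditive.comp_neg, Preadditive.comp_neg,
      ← sub_eq_add_neg, sub_eq_zero] at this
    simpa using this.symm
  refine ⟨_, h.map (k ≫ biprod.fst) ≫ p, ?_, fun Z x hx => ?_⟩
  · rw [Category.assoc, ← ha, ← h.map_comp_assoc, hq.comp_eq_zero_iff]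
    exact ⟨_, hk'⟩
  · obtain ⟨y, rfl⟩ := hp.exists_lift x
    rw [Category.assoc, ← ha, ← h.map_comp_assoc, hq.comp_eq_zero_iff] at hx
    obtain ⟨z, hz⟩ := hx
    obtain ⟨b, hb⟩ := hk.exists_lift (biprod.lift y z) (by simp [hz])
    exact ⟨h.map b, by rw [← h.map_comp_assoc, reassoc_of% hb, biprod.lift_fst]⟩

variable (h) in
lemma exists_mono_repExact [HasWeakKernels D] {F G : A} (φ : F ⟶ G) :
    ∃ (K : A) (ι : K ⟶ F), Mono ι ∧ RepExact h ι φ := by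
  obtain ⟨Y, k, hk⟩ := exists_repExact_obj h φ
  obtain ⟨X, l, hl⟩ := exists_repExact_obj h k
  obtain ⟨l, rfl⟩ := h.map_surjective l
  obtain ⟨K, p, hp⟩ := IsPresentationFunctor.exists_presented (h := h) l
  obtain ⟨ι, hι⟩ := hp.exists_desc k hl.zero
  refine ⟨K, ι, mono_of_rep h fun Z x hx => ?_, hp.hom_ext ?_, fun Z x hx => ?_⟩
  · obtain ⟨y, rfl⟩ := hp.exists_lift x
    rw [Category.assoc, hι] at hx
    obtain ⟨z, hz⟩ := hl.exists_lift _ hx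
    rw [← hz, Category.assoc, hp.zero, comp_zero]
  · rw [comp_zero, reassoc_of% hι, hk.zero]
  · obtain ⟨y, rfl⟩ := hk.exists_lift x hx
    exact ⟨y ≫ p, by rw [Category.assoc, hι]⟩

lemma hasBinaryBiproducts_of_isPresentationFunctor (h : D ⥤ A) [IsPresentationFunctor h] :
    HasBinaryBiproducts A where
  has_binary_biproduct F G := by
    obtain ⟨X', Y', f, p, hp⟩ := IsPresentationFunctor.exists_presentation (h := h) F
    obtain ⟨X, Y, g, q, hq⟩ := IsPresentationFunctor.exists_presentation (h := h) G
    obtain ⟨H, r, hr⟩ := IsPresentationFunctor.exists_presented (h := h) (biprod.map f g)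
    obtain ⟨inl, hinl⟩ := hp.exists_map hr biprod.inl biprod.inl (by simp)
    obtain ⟨inr, hinr⟩ := hq.exists_map hr biprod.inr biprod.inr (by simp)
    obtain ⟨fst, hfst⟩ := hr.exists_map hp biprod.fst biprod.fst (by simp)
    obtain ⟨snd, hsnd⟩ := hr.exists_map hq biprod.snd biprod.snd (by simp)
    let b : BinaryBicone F G :=
      { pt := H, fst := fst, snd := snd, inl := inl, inr := inr
        inl_fst := hp.hom_ext (by simp [reassoc_of% hinl, hfst, ← h.map_comp_assoc])
        inl_snd := hp.hom_ext (by simp [reassoc_of% hinl, hsnd, ← h.map_comp_assoc])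
        inr_fst := hq.hom_ext (by simp [reassoc_of% hinr, hfst, ← h.map_comp_assoc])
        inr_snd := hq.hom_ext (by simp [reassoc_of% hinr, hsnd, ← h.map_comp_assoc]) }
    refine hasBinaryBiproduct_of_total b (hr.hom_ext ?_)
    calc r ≫ (fst ≫ inl + snd ≫ inr)
        = h.map (biprod.fst ≫ biprod.inl + biprod.snd ≫ biprod.inr) ≫ r := by
          rw [Preadditive.comp_add, reassoc_of% hfst, reassoc_of% hsnd, hinl, hinr, h.map_add,
            Preadditive.add_comp, h.map_comp_assoc, h.map_comp_assoc]
      _ = r ≫ 𝟙 H := by rw [biprod.total, h.map_id, Category.id_comp, Category.comp_id]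

lemma hasFiniteProducts_of_isPresentationFunctor (h : D ⥤ A) [IsPresentationFunctor h]
    [HasZeroObject D] : HasFiniteProducts A := by
  have : HasZeroObject A :=
    (HasZeroObject.zero (C := D)).elim fun X hX => ⟨⟨h.obj X, h.map_isZero hX⟩⟩
  have := hasBinaryBiproducts_of_isPresentationFunctor h
  exact hasFiniteProducts_of_has_binary_and_terminal

lemma isAbelianCategory_of_hasWeakKernels (h : D ⥤ A) [IsPresentationFunctor h]
    [HasZeroObject D] [HasWeakKernels D] : IsAbelianCategory A where
  hasFiniteProducts := hasFiniteProducts_of_isPresentationFunctor h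
  hasKernels := ⟨fun φ => by
    obtain ⟨K, ι, _, hι⟩ := exists_mono_repExact h φ
    obtain ⟨hι'⟩ := hι.nonempty_isLimit
    exact ⟨⟨_, hι'⟩⟩⟩
  hasCokernels := ⟨fun φ => by
    obtain ⟨H, π, hφπ, hπ⟩ := exists_repExact_repSurjective h φ
    obtain ⟨hπ'⟩ := hφπ.nonempty_isColimit hπ
    exact ⟨⟨_, hπ'⟩⟩⟩
  isNormalMonoCategory := ⟨fun m _ => by
    obtain ⟨H, π, hmπ, -⟩ := exists_repExact_repSurjective h m
    exact ⟨⟨H, π, hmπ.zero, hmπ.nonempty_isLimit.some⟩⟩⟩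
  isNormalEpiCategory := ⟨fun e _ => by
    obtain ⟨K, ι, -, hιe⟩ := exists_mono_repExact h e
    exact ⟨⟨K, ι, hιe.zero, (hιe.nonempty_isColimit (repSurjective_of_epi h e)).some⟩⟩⟩

end Biproducts

end Presentations

section ProjectiveDimension

universe v₁ u₁ v₂ u₂

variable {D : Type u₁} [Category.{v₁} D]

lemma exists_nonempty_iso_obj_of_retract [IsIdempotentComplete D] {A : Type u₂} [Category.{v₂} A]
    (h : D ⥤ A) [h.Full] [h.Faithful] {P : A} {Y : D} (r : Retract P (h.obj Y)) :
    ∃ X : D, Nonempty (P ≅ h.obj X) := by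
  obtain ⟨e, he⟩ := h.map_surjective (r.r ≫ r.i)
  obtain ⟨X, i, s, his, hsi⟩ := IsIdempotentComplete.idempotents_split Y e
    (h.map_injective (by rw [h.map_comp, he, Category.assoc, r.retract_assoc]))
  have hri : h.map s ≫ h.map i = r.r ≫ r.i := by rw [← h.map_comp, hsi, he]
  have hir : h.map i ≫ h.map s = 𝟙 _ := by rw [← h.map_comp, his, h.map_id]
  exact ⟨X, ⟨{
    hom := r.i ≫ h.map s
    inv := h.map i ≫ r.r
    hom_inv_id := by rw [Category.assoc, reassoc_of% hri, r.retract_assoc, r.retract]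
    inv_hom_id := by rw [Category.assoc, ← reassoc_of% hri, reassoc_of% hir, hir] }⟩⟩

variable [Preadditive D] {A : Type u₂} [Category.{v₂} A] [Abelian A] {h : D ⥤ A}
  [IsPresentationFunctor h]

lemma RepExact.exact {F G H : A} {u : F ⟶ G} {w : G ⟶ H} (huw : RepExact h u w) :
    (ShortComplex.mk u w huw.zero).Exact := by
  rw [ShortComplex.exact_iff_exact_up_to_refinements]
  intro T t (ht : t ≫ w = 0)
  obtain ⟨X, Y, f, p, hp⟩ := IsPresentationFunctor.exists_presentation (h := h) T
  obtain ⟨y, hy⟩ := huw.exists_lift (p ≫ t) (by rw [Category.assoc, ht, comp_zero])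
  exact ⟨_, p, hp.epi, y, hy.symm⟩

lemma Presents.exists_shortExact {K X Y : D} {k : K ⟶ X} {f : X ⟶ Y} {F G : A}
    {p : h.obj Y ⟶ F} {q : h.obj X ⟶ G} (hp : Presents h f p) (hq : Presents h k q)
    (hk : IsWeakKernel k f) :
    ∃ (ι : G ⟶ h.obj Y) (w : ι ≫ p = 0), q ≫ ι = h.map f ∧
      (ShortComplex.mk ι p w).ShortExact := by
  obtain ⟨ι, hι⟩ := hq.exists_desc (h.map f) (by rw [← h.map_comp, hk.zero, h.map_zero])
  have hιp : RepExact h ι p :=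
    { zero := hq.hom_ext (by rw [reassoc_of% hι, hp.zero, comp_zero])
      exists_lift := fun Z x hx => by
        obtain ⟨y, hy⟩ := hp.repExact.exists_lift x hx
        exact ⟨y ≫ q, by rw [Category.assoc, hι, hy]⟩ }
  have : Mono ι := mono_of_rep h fun Z x hx => by
    obtain ⟨a, rfl⟩ := hq.exists_lift x
    rw [Category.assoc, hι, ← h.map_comp, h.map_eq_zero_iff] at hx
    exact (hq.comp_eq_zero_iff a).2 (hk.exists_lift a hx)
  exact ⟨ι, hιp.zero, hι, { exact := hιp.exact, mono_f := this, epi_g := hp.epi }⟩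

lemma Presents.shortExact_of_mono {X Y : D} {f : X ⟶ Y} [Mono f] {F : A} {p : h.obj Y ⟶ F}
    (hp : Presents h f p) : (ShortComplex.mk (h.map f) p hp.zero).ShortExact where
  exact := hp.repExact.exact
  mono_f := mono_of_rep h fun Z x hx => by
    obtain ⟨a, rfl⟩ := h.map_surjective x
    rw [← h.map_comp, h.map_eq_zero_iff] at hx
    rw [zero_of_comp_mono f hx, h.map_zero]
  epi_g := hp.epi

lemma hasWeakKernels_of_abelian (h : D ⥤ A) [IsPresentationFunctor h] : HasWeakKernels D where
  hasWeakLimit {X Y} f := by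
    obtain ⟨_, P, _, c, hc⟩ := IsPresentationFunctor.exists_presentation (h := h) (kernel (h.map f))
    obtain ⟨k, hk⟩ := h.map_surjective (c ≫ kernel.ι _)
    refine (isWeakKernel_of_repExact (h := h) (k := k) ⟨?_, fun Z x hx => ?_⟩).hasWeakKernel
    · rw [hk, Category.assoc, kernel.condition, comp_zero]
    · obtain ⟨y, hy⟩ := hc.exists_lift (kernel.lift _ x hx)
      exact ⟨h.map y, by rw [hk, reassoc_of% hy, kernel.lift_ι]⟩

lemma exists_nonempty_iso_obj_of_projective [IsIdempotentComplete D] (h : D ⥤ A)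
    [IsPresentationFunctor h] (P : A) [Projective P] : ∃ X : D, Nonempty (P ≅ h.obj X) := by
  obtain ⟨_, Y, _, p, hp⟩ := IsPresentationFunctor.exists_presentation (h := h) P
  have := hp.epi
  exact exists_nonempty_iso_obj_of_retract h ⟨_, p, Projective.factorThru_comp (𝟙 P) p⟩

variable [HasBinaryBiproducts D]

lemma Presents.hasProjectiveDimensionLE_one_of_mono {X Y : D} {f : X ⟶ Y} [Mono f] {F : A}
    {p : h.obj Y ⟶ F} (hp : Presents h f p) : HasProjectiveDimensionLE F 1 :=
  (hp.shortExact_of_mono.hasProjectiveDimensionLT_X₃_iff 0 (projective_obj h Y)).2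
    (projective_iff_hasProjectiveDimensionLT_one.1 (projective_obj h X))

lemma Presents.hasProjectiveDimensionLE_succ_iff {K X Y : D} {k : K ⟶ X} {f : X ⟶ Y} {F G : A}
    {p : h.obj Y ⟶ F} {q : h.obj X ⟶ G} (hp : Presents h f p) (hq : Presents h k q)
    (hk : IsWeakKernel k f) (d : ℕ) :
    HasProjectiveDimensionLE F (d + 1) ↔ HasProjectiveDimensionLE G d := by
  obtain ⟨ι, w, -, hS⟩ := hp.exists_shortExact hq hk
  exact hS.hasProjectiveDimensionLT_X₃_iff d (projective_obj h Y)

lemma InitIsNKernelOfLast.hasProjectiveDimensionLE {n : ℕ} {Z : ComposableArrows D (n + 1)}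
    (hZ : InitIsNKernelOfLast Z) (m : ℕ) (hm : m ≤ n) {F : A} {p : h.obj (Z.obj' (m + 1)) ⟶ F}
    (hp : Presents h (Z.map' m (m + 1)) p) : HasProjectiveDimensionLE F (m + 1) := by
  obtain ⟨_, hk⟩ := initIsNKernelOfLast_iff.1 hZ
  induction m generalizing F with
  | zero => exact hp.hasProjectiveDimensionLE_one_of_mono
  | succ m ih =>
    obtain ⟨G, q, hq⟩ := IsPresentationFunctor.exists_presented (h := h) (Z.map' m (m + 1))
    exact (hp.hasProjectiveDimensionLE_succ_iff hq (hk m (by lia)) _).2 (ih (by lia) hq)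

lemma Presents.exists_isWeakKernelSequence (m d : ℕ) {X Y : D} {f : X ⟶ Y} {F : A}
    {p : h.obj Y ⟶ F} (hp : Presents h f p) (hF : HasProjectiveDimensionLE F (d + m + 1)) :
    ∃ Z : ComposableArrows D (m + 1), Nonempty (Arrow.mk (Z.map' m (m + 1)) ≅ Arrow.mk f) ∧
      IsWeakKernelSequence Z ∧ ∃ (G : A) (q : h.obj (Z.obj' 1) ⟶ G),
        Presents h (Z.map' 0 1) q ∧ HasProjectiveDimensionLE G (d + 1) := by
  induction m generalizing d with
  | zero => exact ⟨.mk₁ f, ⟨Iso.refl _⟩, fun i hi => absurd hi (by lia), F, p, hp, hF⟩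
  | succ m ih =>
    obtain ⟨Z, e, hZ, G, q, hq, hG⟩ := ih (d + 1) (by rwa [add_right_comm d 1 m])
    have := hasWeakKernels_of_abelian h
    obtain ⟨K, k, hk⟩ := exists_isWeakKernel (Z.map' 0 1)
    obtain ⟨G', q', hq'⟩ := IsPresentationFunctor.exists_presented (h := h) k
    exact ⟨Z.precomp k, e, isWeakKernelSequence_precomp_iff.2 ⟨hk, hZ⟩, G', q', hq',
      (hq.hasProjectiveDimensionLE_succ_iff hq' hk _).1 hG⟩

variable [IsIdempotentComplete D]

lemma Presents.exists_isSplitEpi_comp_mono {X Y : D} {f : X ⟶ Y} {F : A} {p : h.obj Y ⟶ F}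
    (hp : Presents h f p) (hF : HasProjectiveDimensionLE F 1) :
    ∃ (P : D) (s : X ⟶ P) (g : P ⟶ Y), IsSplitEpi s ∧ Mono g ∧ s ≫ g = f := by
  have := hasWeakKernels_of_abelian h
  obtain ⟨K, k, hk⟩ := exists_isWeakKernel f
  obtain ⟨G, q, hq⟩ := IsPresentationFunctor.exists_presented (h := h) k
  obtain ⟨ι, w, hι, hS⟩ := hp.exists_shortExact hq hk
  have : Projective G := (projective_iff_hasProjectiveDimensionLE_zero G).2
    ((hp.hasProjectiveDimensionLE_succ_iff hq hk 0).1 hF)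
  obtain ⟨P, ⟨e⟩⟩ := exists_nonempty_iso_obj_of_projective h G
  obtain ⟨s, hs⟩ := h.map_surjective (q ≫ e.hom)
  obtain ⟨g, hg⟩ := h.map_surjective (e.inv ≫ ι)
  have := hq.epi
  have := hS.mono_f
  have : IsSplitEpi q := ⟨⟨⟨_, Projective.factorThru_comp (𝟙 G) q⟩⟩⟩
  have hs' : IsSplitEpi (h.map s) := hs ▸ inferInstance
  have hg' : Mono (h.map g) := hg ▸ inferInstance
  refine ⟨P, s, g, (h.isSplitEpi_iff s).1 hs', h.mono_of_mono_map hg', h.map_injective ?_⟩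
  rw [h.map_comp, hs, hg, Category.assoc, e.hom_inv_id_assoc, hι]

lemma Presents.exists_mono_isWeakKernel {X Y : D} {f : X ⟶ Y} {F : A} {p : h.obj Y ⟶ F}
    (hp : Presents h f p) (hF : HasProjectiveDimensionLE F 2) :
    ∃ (K : D) (k : K ⟶ X), Mono k ∧ IsWeakKernel k f := by
  have := hasWeakKernels_of_abelian h
  obtain ⟨K', k, hk⟩ := exists_isWeakKernel f
  obtain ⟨G, q, hq⟩ := IsPresentationFunctor.exists_presented (h := h) k
  obtain ⟨K, s, g, _, hg, rfl⟩ := hq.exists_isSplitEpi_comp_mono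
    ((hp.hasProjectiveDimensionLE_succ_iff hq hk 1).1 hF)
  exact ⟨K, g, hg, isWeakKernel_splitEpi_comp_iff.1 hk⟩

lemma Presents.exists_initIsNKernelOfLast {n : ℕ} {X Y : D} {f : X ⟶ Y} {F : A} {p : h.obj Y ⟶ F}
    (hp : Presents h f p) (hF : HasProjectiveDimensionLE F (n + 2)) :
    ∃ Z : ComposableArrows D (n + 2),
      Nonempty (Arrow.mk (Z.map' (n + 1) (n + 2)) ≅ Arrow.mk f) ∧ InitIsNKernelOfLast Z := by
  obtain ⟨Z, e, hZ, G, q, hq, hG⟩ := hp.exists_isWeakKernelSequence n 1 (by rwa [add_comm 1 n])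
  obtain ⟨K, k, hk, hkZ⟩ := hq.exists_mono_isWeakKernel hG
  exact ⟨Z.precomp k, e,
    initIsNKernelOfLast_iff.2 ⟨hk, isWeakKernelSequence_precomp_iff.2 ⟨hkZ, hZ⟩⟩⟩

end ProjectiveDimension

section GlobalDimension

universe v₁ u₁ v₂ u₂

lemma hasWeakKernels_of_hasNKernels {D : Type u₁} [Category.{v₁} D] [Preadditive D] {n : ℕ}
    (hn : 1 ≤ n) (hD : HasNKernels D n) : HasWeakKernels D where
  hasWeakLimit f := by
    obtain ⟨Z, ⟨e⟩, hZ⟩ := hD f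
    obtain ⟨m, rfl⟩ := Nat.exists_eq_add_of_le' hn
    exact (((initIsNKernelOfLast_iff.1 hZ).2 m (by lia)).of_arrow_iso e).hasWeakKernel

lemma globalDimension_le_iff {A : Type u₂} [Category.{v₂} A] [Abelian A] {d : ℕ} :
    globalDimension A ≤ (d : WithBot ℕ∞) ↔ ∀ F : A, HasProjectiveDimensionLE F d := by
  simp only [globalDimension, iSup_le_iff, projectiveDimension_le_iff]

variable {D : Type u₁} [Category.{v₁} D] [Preadditive D] [HasBinaryBiproducts D]
  {A : Type u₂} [Category.{v₂} A]

lemma HasNKernels.globalDimension_le [Abelian A] (h : D ⥤ A) [IsPresentationFunctor h] {n : ℕ}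
    (hD : HasNKernels D n) : globalDimension A ≤ ((n + 1 : ℕ) : WithBot ℕ∞) :=
  globalDimension_le_iff.2 fun F => by
    obtain ⟨_, _, f, p, hp⟩ := IsPresentationFunctor.exists_presentation (h := h) F
    obtain ⟨Z, ⟨e⟩, hZ⟩ := hD f
    exact hZ.hasProjectiveDimensionLE n le_rfl (hp.of_arrow_iso e.symm)

lemma hasNKernels_of_globalDimension_le [IsIdempotentComplete D] [Abelian A] (h : D ⥤ A)
    [IsPresentationFunctor h] {n : ℕ}
    (hA : globalDimension A ≤ ((n + 2 : ℕ) : WithBot ℕ∞)) : HasNKernels D (n + 1) := fun _ _ f => by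
  obtain ⟨F, p, hp⟩ := IsPresentationFunctor.exists_presented (h := h) f
  exact hp.exists_initIsNKernelOfLast (globalDimension_le_iff.1 hA F)

theorem hasNKernels_iff [HasZeroObject D] [IsIdempotentComplete D] [Preadditive A] (h : D ⥤ A)
    [IsPresentationFunctor h] {n : ℕ} (hn : 1 ≤ n) :
    HasNKernels D n ↔ ∃ _ : IsAbelianCategory A,
      letI := IsAbelianCategory.abelian A
      globalDimension A ≤ ((n + 1 : ℕ) : WithBot ℕ∞) := by
  constructor
  · intro hD
    have := hasWeakKernels_of_hasNKernels hn hD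
    have hA := isAbelianCategory_of_hasWeakKernels h
    let := IsAbelianCategory.abelian A
    exact ⟨hA, hD.globalDimension_le h⟩
  · rintro ⟨_, hA⟩
    obtain ⟨m, rfl⟩ := Nat.exists_eq_add_of_le' hn
    let := IsAbelianCategory.abelian A
    exact hasNKernels_of_globalDimension_le h hA

end GlobalDimension

section Ext

universe w v₁ u₁ v₂ u₂

open Abelian

section ShortExact

variable {A : Type u₁} [Category.{v₁} A] [Abelian A] [HasExt.{w} A] {S : ShortComplex A}

lemma subsingleton_ext_succ_iff_of_shortExact (hS : S.ShortExact) [Projective S.X₂] (M : A)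
    (i : ℕ) : Subsingleton (Ext S.X₃ M (i + 2)) ↔ Subsingleton (Ext S.X₁ M (i + 1)) := by
  constructor
  · intro _
    refine subsingleton_of_forall_eq 0 fun x => ?_
    obtain ⟨y, rfl⟩ := Ext.contravariant_sequence_exact₁ hS M x (n₁ := i + 2) (by lia)
      (Subsingleton.elim _ _)
    rw [Ext.eq_zero_of_projective y, Ext.comp_zero]
  · intro _
    refine subsingleton_of_forall_eq 0 fun x => ?_
    obtain ⟨y, rfl⟩ := Ext.contravariant_sequence_exact₃ hS M x
      (Ext.eq_zero_of_projective _) (n₀ := i + 1) (by lia)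
    rw [Subsingleton.elim y 0, Ext.comp_zero]

lemma subsingleton_ext_one_iff_of_shortExact (hS : S.ShortExact) [Projective S.X₂] (M : A) :
    Subsingleton (Ext S.X₃ M 1) ↔ ∀ a : S.X₁ ⟶ M, ∃ b : S.X₂ ⟶ M, S.f ≫ b = a := by
  constructor
  · intro _ a
    obtain ⟨y, hy⟩ := Ext.contravariant_sequence_exact₁ hS M (Ext.mk₀ a) (n₁ := 1) (by lia)
      (Subsingleton.elim _ _)
    obtain ⟨b, rfl⟩ := Ext.homEquiv₀.symm.surjective y
    refine ⟨b, ?_⟩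
    rw [Ext.homEquiv₀_symm_apply, Ext.mk₀_comp_mk₀] at hy
    exact Ext.homEquiv₀.symm.injective hy
  · intro hext
    refine subsingleton_of_forall_eq 0 fun x => ?_
    obtain ⟨y, rfl⟩ := Ext.contravariant_sequence_exact₃ hS M x
      (Ext.eq_zero_of_projective _) (n₀ := 0) (by lia)
    obtain ⟨a, rfl⟩ := Ext.homEquiv₀.symm.surjective y
    obtain ⟨b, rfl⟩ := hext a
    rw [Ext.homEquiv₀_symm_apply, ← Ext.mk₀_comp_mk₀, hS.extClass_comp_assoc]

end ShortExact

variable {D : Type u₁} [Category.{v₁} D] [Preadditive D] [HasBinaryBiproducts D] {A : Type u₂}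
  [Category.{v₂} A] [Abelian A] [HasExt.{w} A] {h : D ⥤ A} [IsPresentationFunctor h]

lemma Presents.subsingleton_ext_succ_iff {K X Y : D} {k : K ⟶ X} {f : X ⟶ Y} {F G : A}
    {p : h.obj Y ⟶ F} {q : h.obj X ⟶ G} (hp : Presents h f p) (hq : Presents h k q)
    (hk : IsWeakKernel k f) (M : A) (i : ℕ) :
    Subsingleton (Ext F M (i + 2)) ↔ Subsingleton (Ext G M (i + 1)) := by
  obtain ⟨ι, w, -, hS⟩ := hp.exists_shortExact hq hk
  have : Projective (ShortComplex.mk ι p w).X₂ := projective_obj h Y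
  exact subsingleton_ext_succ_iff_of_shortExact hS M i

lemma Presents.forall_subsingleton_ext_one_iff {K X Y : D} {k : K ⟶ X} {f : X ⟶ Y} {F : A}
    {p : h.obj Y ⟶ F} (hp : Presents h f p) (hk : IsWeakKernel k f) :
    (∀ W : D, Subsingleton (Ext F (h.obj W) 1)) ↔ IsWeakCokernel k f := by
  obtain ⟨G, q, hq⟩ := IsPresentationFunctor.exists_presented (h := h) k
  obtain ⟨ι, w, hι, hS⟩ := hp.exists_shortExact hq hk
  have : Projective (ShortComplex.mk ι p w).X₂ := projective_obj h Y
  simp only [subsingleton_ext_one_iff_of_shortExact hS]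
  refine ⟨fun hext => ⟨hk.zero, fun {W} a ha => ?_⟩, fun hf W a => ?_⟩
  · obtain ⟨c, hc⟩ := hq.exists_desc (h.map a) (by rw [← h.map_comp, ha, h.map_zero])
    obtain ⟨b, rfl⟩ := hext W c
    obtain ⟨b, rfl⟩ := h.map_surjective b
    exact ⟨b, h.map_injective (by rw [h.map_comp, ← hc, reassoc_of% hι])⟩
  · obtain ⟨c, hc⟩ := h.map_surjective (q ≫ a)
    obtain ⟨b, rfl⟩ := hf.exists_desc c (h.map_injective (by
      rw [h.map_comp, hc, reassoc_of% hq.zero, zero_comp, h.map_zero]))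
    exact ⟨h.map b, hq.hom_ext (by rw [reassoc_of% hι, ← h.map_comp, hc])⟩

end Ext

section TorsionFree

universe w v₁ u₁ v₂ u₂ v₃ u₃

open Abelian

variable {D : Type u₁} [Category.{v₁} D] {A : Type u₂} [Category.{v₂} A] [Preadditive A]
  {A' : Type u₃} [Category.{v₃} A'] [Abelian A'] [HasExt.{w} A']

/-- The `n`-torsion freeness of a module `F`, with right and left modules given by the presentation
functors `h` and `h'`. As transposes are unique only up to projective summands, all of them are
considered. -/
def IsTorsionFree (h : D ⥤ A) (h' : Dᵒᵖ ⥤ A') (n : ℕ) (F : A) : Prop :=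
  ∀ ⦃X Y : D⦄ (f : X ⟶ Y) (p : h.obj Y ⟶ F) (T : A') (q : h'.obj (op X) ⟶ T),
    Presents h f p → Presents h' f.op q →
      ∀ i : ℕ, 1 ≤ i → i ≤ n → ∀ W : Dᵒᵖ, Subsingleton (Ext T (h'.obj W) i)

variable [Preadditive D] [HasBinaryBiproducts D] {h' : Dᵒᵖ ⥤ A'} [IsPresentationFunctor h']

lemma IsWeakCokernelSequence.forall_subsingleton_ext_iff {m : ℕ} {Z : ComposableArrows D m}
    (hZ : IsWeakCokernelSequence Z) (k i j : ℕ) (hij : i + k = j) (hj : j + 1 < m) {T : A'}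
    {q : h'.obj (op (Z.obj' i)) ⟶ T} (hq : Presents h' (Z.map' i (i + 1)).op q) :
    (∀ W, Subsingleton (Ext T (h'.obj W) (k + 1))) ↔
      IsWeakKernel (Z.map' j (j + 1)) (Z.map' (j + 1) (j + 2)) := by
  induction k generalizing i T with
  | zero =>
    obtain rfl : i = j := hij
    rw [zero_add, hq.forall_subsingleton_ext_one_iff (isWeakKernel_op_iff.2 (hZ i hj)),
      isWeakCokernel_op_iff]
  | succ k ih =>
    obtain ⟨T', q', hq'⟩ := IsPresentationFunctor.exists_presented (h := h')
      (Z.map' (i + 1) (i + 2)).op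
    rw [← ih (i + 1) (by lia) hq']
    exact forall_congr' fun W =>
      hq.subsingleton_ext_succ_iff hq' (isWeakKernel_op_iff.2 (hZ i (by lia))) _ k

end TorsionFree

section MonosAreNKernels

universe w v₁ u₁ v₂ u₂ v₃ u₃

variable {D : Type u₁} [Category.{v₁} D] [Preadditive D] [HasBinaryBiproducts D]
  [IsIdempotentComplete D] {A : Type u₂} [Category.{v₂} A] [Abelian A]
  {A' : Type u₃} [Category.{v₃} A'] [Abelian A'] [HasExt.{w} A']
  (h : D ⥤ A) [IsPresentationFunctor h] (h' : Dᵒᵖ ⥤ A') [IsPresentationFunctor h']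

variable {h} in
lemma MonosAreNKernels.isWeakKernelSequence {n : ℕ} (hD : MonosAreNKernels D n)
    {Z : ComposableArrows D (n + 1)} (hZ : TailIsNCokernelOfFirst Z) {F : A}
    {p : h.obj (Z.obj' 1) ⟶ F} (hp : Presents h (Z.map' 0 1) p)
    (hF : HasProjectiveDimensionLE F 1) : IsWeakKernelSequence Z := by
  obtain _ | n := n
  · exact fun i hi => absurd hi (by lia)
  obtain ⟨Z, X, z, rfl⟩ := ComposableArrows.precomp_surjective Z
  obtain ⟨P, s, g, _, hg, rfl⟩ : ∃ (P : D) (s : X ⟶ P) (g : P ⟶ Z.left),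
      IsSplitEpi s ∧ Mono g ∧ s ≫ g = z := hp.exists_isSplitEpi_comp_mono hF
  rw [tailIsNCokernelOfFirst_iff, isWeakCokernelSequence_precomp_iff,
    isWeakCokernel_epi_comp_iff] at hZ
  have hgZ : TailIsNCokernelOfFirst (Z.precomp g) :=
    tailIsNCokernelOfFirst_iff.2 ⟨hZ.1, isWeakCokernelSequence_precomp_iff.2 hZ.2⟩
  rw [isWeakKernelSequence_precomp_iff, isWeakKernel_splitEpi_comp_iff]
  exact isWeakKernelSequence_precomp_iff.1 (initIsNKernelOfLast_iff.1 (hD _ hg hgZ)).2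

theorem monosAreNKernels_iff {n : ℕ} (hD : HasNCokernels D n) :
    MonosAreNKernels D n ↔
      ∀ F : A, HasProjectiveDimensionLE F 1 → IsTorsionFree h h' n F := by
  constructor
  · intro H F hF X Y f p T q hp hq i hi₁ hin
    obtain ⟨Z, ⟨e⟩, hZ⟩ := hD f
    obtain ⟨e'⟩ := nonempty_arrow_op_iso_iff.2 ⟨e.symm⟩
    obtain ⟨k, rfl⟩ := Nat.exists_eq_add_of_le' hi₁
    exact ((tailIsNCokernelOfFirst_iff.1 hZ).2.forall_subsingleton_ext_iff k 0 k (zero_add k)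
      (by lia) (hq.of_arrow_iso e')).2
        (H.isWeakKernelSequence hZ (hp.of_arrow_iso e.symm) hF k (by lia))
  · intro H Z hZ₀ hZ
    obtain ⟨F, p, hp⟩ := IsPresentationFunctor.exists_presented (h := h) (Z.map' 0 1)
    obtain ⟨T, q, hq⟩ := IsPresentationFunctor.exists_presented (h := h') (Z.map' 0 1).op
    have hF := H F hp.hasProjectiveDimensionLE_one_of_mono _ p T q hp hq
    exact initIsNKernelOfLast_iff.2 ⟨hZ₀, fun i hi =>
      ((tailIsNCokernelOfFirst_iff.1 hZ).2.forall_subsingleton_ext_iff i 0 i (zero_add i) hi hq).1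
        (hF (i + 1) (by lia) (by lia))⟩

end MonosAreNKernels

section FunctorCategory

universe v₁ u₁ v₂ u₂

section RightExact

variable {E : Type u₁} [Category.{v₁} E]

/-- The sequence of functors `F ⟶ G ⟶ H ⟶ 0` is exact at each object. -/
def IsRightExactSeq {F G H : E ⥤ AddCommGrpCat.{v}} (φ : F ⟶ G) (p : G ⟶ H) : Prop :=
  ∀ Z : E, Function.Exact (φ.app Z).hom (p.app Z).hom ∧ Function.Surjective (p.app Z).hom

lemma isRightExactSeq_cokernel {F G : E ⥤ AddCommGrpCat.{v}} (φ : F ⟶ G) :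
    IsRightExactSeq φ (cokernel.π φ) := fun Z =>
  ⟨(ShortComplex.ab_exact_iff_function_exact _).1
    ((ShortComplex.exact_cokernel φ).map ((evaluation E AddCommGrpCat.{v}).obj Z)),
    (AddCommGrpCat.epi_iff_surjective _).1 (inferInstanceAs (Epi ((cokernel.π φ).app Z)))⟩

variable {F G H : E ⥤ AddCommGrpCat.{v}} {φ : F ⟶ G} {p : G ⟶ H}

lemma IsRightExactSeq.zero (hp : IsRightExactSeq φ p) : φ ≫ p = 0 := by
  ext Z x
  exact ((hp Z).1 _).2 ⟨x, rfl⟩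

lemma IsRightExactSeq.epi_app (hp : IsRightExactSeq φ p) (Z : E) : Epi (p.app Z) :=
  (AddCommGrpCat.epi_iff_surjective _).2 (hp Z).2

lemma IsRightExactSeq.epi (hp : IsRightExactSeq φ p) : Epi p :=
  have := hp.epi_app
  NatTrans.epi_of_epi_app p

lemma IsRightExactSeq.exists_desc (hp : IsRightExactSeq φ p) {T : E ⥤ AddCommGrpCat.{v}}
    (q : G ⟶ T) (hq : φ ≫ q = 0) : ∃ r : H ⟶ T, p ≫ r = q := by
  have exists_desc_app (Z : E) : ∃ r : H.obj Z ⟶ T.obj Z, p.app Z ≫ r = q.app Z := by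
    refine ⟨AddCommGrpCat.ofHom (AddMonoidHom.liftOfSurjective (p.app Z).hom (hp Z).2
      ⟨(q.app Z).hom, fun x hx => ?_⟩), ?_⟩
    · obtain ⟨y, rfl⟩ := ((hp Z).1 x).1 hx
      exact ConcreteCategory.congr_hom (NatTrans.congr_app hq Z) y
    · ext x
      exact AddMonoidHom.liftOfRightInverse_comp_apply _ _
        (Function.rightInverse_surjInv (hp Z).2) _ x
  choose r hr using exists_desc_app
  refine ⟨{ app := r, naturality := fun X Y f => ?_ }, by ext Z : 2; exact hr Z⟩
  have := hp.epi_app X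
  rw [← cancel_epi (p.app X), ← NatTrans.naturality_assoc, hr, reassoc_of% hr, q.naturality]

lemma IsRightExactSeq.additive [Preadditive E] [G.Additive] (hp : IsRightExactSeq φ p) :
    H.Additive where
  map_add {X Y f g} := by
    have := hp.epi_app X
    rw [← cancel_epi (p.app X), Preadditive.comp_add, ← NatTrans.naturality,
      ← NatTrans.naturality, ← NatTrans.naturality, G.map_add, Preadditive.add_comp]

end RightExact

variable {E : Type u₁} [Category.{v₁} E] [Preadditive E] {D : Type u₂} [Category.{v₂} D]

/-- For each `Z`, an element of `y.obj Z` at `e Z` such that evaluation at it identifies the natural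
transformations from `y.obj Z` to an additive functor `F` with the elements of `F` at `e Z`: the
Yoneda lemma, simultaneously for right modules (`e = op`) and left modules (`e = unop`). -/
structure UniversalElements (y : D ⥤ E ⥤ AddCommGrpCat.{v}) (e : D → E) where
  elt (Z : D) : (y.obj Z).obj (e Z)
  additive (Z : D) : (y.obj Z).Additive
  surjective : Function.Surjective e
  bijective (Z : D) (F : E ⥤ AddCommGrpCat.{v}) [F.Additive] :
    Function.Bijective fun η : y.obj Z ⟶ F => (η.app (e Z)).hom (elt Z)

variable {y : D ⥤ E ⥤ AddCommGrpCat.{v}} {e : D → E} {P : ObjectProperty (E ⥤ AddCommGrpCat.{v})}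

lemma UniversalElements.presents_iff (U : UniversalElements y e) [y.Full] [y.Faithful]
    (hy : ∀ Z, P (y.obj Z)) {X Y : D} (f : X ⟶ Y) {F : P.FullSubcategory} [F.obj.Additive]
    (p : (P.lift y hy).obj Y ⟶ F) :
    Presents (P.lift y hy) f p ↔ IsRightExactSeq (y.map f) p.hom := by
  have hX := U.additive X
  have hY := U.additive Y
  constructor
  · intro hp Z
    obtain ⟨Z, rfl⟩ := U.surjective Z
    have zero : y.map f ≫ p.hom = 0 := congrArg (fun t => t.hom) hp.zero
    refine ⟨fun x => ⟨fun hx => ?_, ?_⟩, fun x => ?_⟩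
    · obtain ⟨η, rfl⟩ := (U.bijective Z _).2 x
      obtain ⟨a, rfl⟩ := y.map_surjective η
      obtain ⟨b, rfl⟩ := (hp.comp_eq_zero_iff a).1
        (ObjectProperty.hom_ext _ ((U.bijective Z F.obj).1 hx))
      exact ⟨((y.map b).app _).hom (U.elt Z), by rw [y.map_comp]; rfl⟩
    · rintro ⟨z, rfl⟩
      exact ConcreteCategory.congr_hom (NatTrans.congr_app zero _) z
    · obtain ⟨η, rfl⟩ := (U.bijective Z _).2 x
      obtain ⟨a, ha⟩ := hp.exists_lift (ObjectProperty.homMk η : (P.lift y hy).obj Z ⟶ F)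
      obtain rfl : y.map a ≫ p.hom = η := congrArg (fun t => t.hom) ha
      exact ⟨((y.map a).app _).hom (U.elt Z), rfl⟩
  · intro hp
    refine ⟨fun {Z} a => ⟨fun ha => ?_, ?_⟩, fun {Z} x => ?_⟩
    · have ha' : y.map a ≫ p.hom = 0 := congrArg (fun t => t.hom) ha
      obtain ⟨z, hz⟩ := ((hp (e Z)).1 (((y.map a).app _).hom (U.elt Z))).1
        (ConcreteCategory.congr_hom (NatTrans.congr_app ha' _) (U.elt Z))
      obtain ⟨η, rfl⟩ := (U.bijective Z _).2 z
      obtain ⟨b, rfl⟩ := y.map_surjective η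
      refine ⟨b, y.map_injective ((U.bijective Z _).1 ?_)⟩
      simp only [y.map_comp]
      exact hz
    · rintro ⟨b, rfl⟩
      refine ObjectProperty.hom_ext _ (?_ : y.map (b ≫ f) ≫ p.hom = 0)
      rw [y.map_comp, Category.assoc, hp.zero, comp_zero]
    · obtain ⟨z, hz⟩ := (hp (e Z)).2 ((x.hom.app _).hom (U.elt Z))
      obtain ⟨η, rfl⟩ := (U.bijective Z _).2 z
      obtain ⟨a, rfl⟩ := y.map_surjective η
      exact ⟨a, ObjectProperty.hom_ext _ ((U.bijective Z F.obj).1 hz)⟩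

lemma UniversalElements.isPresentationFunctor [Preadditive D] (U : UniversalElements y e) [y.Full]
    [y.Faithful] [y.Additive] (hy : ∀ Z, P (y.obj Z))
    (hP : ∀ F, P F ↔ F.Additive ∧
      ∃ (X Y : D) (f : X ⟶ Y) (p : y.obj Y ⟶ F), IsRightExactSeq (y.map f) p) :
    IsPresentationFunctor (P.lift y hy) := by
  have hadd (F : P.FullSubcategory) : F.obj.Additive := ((hP _).1 F.property).1
  exact
  { toFull := inferInstance
    toFaithful := inferInstance
    toAdditive := ⟨fun {X Y f g} => ObjectProperty.hom_ext _ y.map_add⟩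
    exists_presentation := fun F => by
      obtain ⟨-, X, Y, f, p, hp⟩ := (hP _).1 F.property
      exact ⟨X, Y, f, ObjectProperty.homMk p, (U.presents_iff hy f _).2 hp⟩
    exists_presented := fun {X Y} f => by
      have := U.additive Y
      have hf := isRightExactSeq_cokernel (y.map f)
      let F : P.FullSubcategory := ⟨_, (hP _).2 ⟨hf.additive, X, Y, f, _, hf⟩⟩
      exact ⟨F, ObjectProperty.homMk (cokernel.π (y.map f)), (U.presents_iff hy f _).2 hf⟩
    epi := fun {X Y f F p} hp =>
      have := ((U.presents_iff hy f _).1 hp).epi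
      P.ι.epi_of_epi_map this
    exists_desc := fun {X Y f F p} hp {G} q hq => by
      obtain ⟨r, hr⟩ := ((U.presents_iff hy f _).1 hp).exists_desc q.hom
        (congrArg (fun t => t.hom) hq)
      exact ⟨ObjectProperty.homMk r, ObjectProperty.hom_ext _ hr⟩ }

end FunctorCategory

section Modules

variable {C : Type u} [Category.{v} C] [Preadditive C]

lemma preadditiveYoneda_app_apply {Z : C} {F : Cᵒᵖ ⥤ AddCommGrpCat.{v}}
    (η : preadditiveYoneda.obj Z ⟶ F) {W : C} (a : W ⟶ Z) :
    (η.app (op W)).hom a = (F.map a.op).hom ((η.app (op Z)).hom (𝟙 Z)) := by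
  have := ConcreteCategory.congr_hom (η.naturality a.op) (𝟙 Z : Z ⟶ Z)
  change (η.app (op W)).hom (a ≫ 𝟙 Z) = _ at this
  rwa [Category.comp_id] at this

lemma preadditiveCoyoneda_app_apply {Z : Cᵒᵖ} {F : C ⥤ AddCommGrpCat.{v}}
    (η : preadditiveCoyoneda.obj Z ⟶ F) {W : C} (a : Z.unop ⟶ W) :
    (η.app W).hom a = (F.map a).hom ((η.app Z.unop).hom (𝟙 Z.unop)) := by
  have := ConcreteCategory.congr_hom (η.naturality a) (𝟙 Z.unop)
  change (η.app W).hom (𝟙 Z.unop ≫ a) = _ at this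
  rwa [Category.id_comp] at this

variable (C) in
/-- The identities as universal elements of the representable right modules. -/
def rightUniversalElements : UniversalElements (preadditiveYoneda (C := C)) op where
  elt Z := (𝟙 Z : Z ⟶ Z)
  additive Z := inferInstance
  surjective W := ⟨W.unop, rfl⟩
  bijective Z F _ := by
    refine ⟨fun η η' H => ?_, fun x => ⟨
      { app W := AddCommGrpCat.ofHom (AddMonoidHom.mk'
          (fun a : W.unop ⟶ Z => (F.map a.op).hom x) fun a b => ?_)
        naturality W W' g := ?_ }, ?_⟩⟩
    · ext W a
      exact (preadditiveYoneda_app_apply η a).trans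
        ((congrArg _ H).trans (preadditiveYoneda_app_apply η' a).symm)
    · exact ConcreteCategory.congr_hom (F.map_add (f := a.op) (g := b.op)) x
    · ext a
      exact ConcreteCategory.congr_hom (F.map_comp (Quiver.Hom.op a) g) x
    · exact ConcreteCategory.congr_hom (F.map_id (op Z)) x

variable (C) in
/-- The identities as universal elements of the representable left modules. -/
def leftUniversalElements : UniversalElements (preadditiveCoyoneda (C := C)) unop where
  elt Z := (𝟙 Z.unop : Z.unop ⟶ Z.unop)
  additive Z := inferInstance
  surjective W := ⟨op W, rfl⟩
  bijective Z F _ := by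
    refine ⟨fun η η' H => ?_, fun x => ⟨
      { app W := AddCommGrpCat.ofHom (AddMonoidHom.mk'
          (fun a : Z.unop ⟶ W => (F.map a).hom x) fun a b => ?_)
        naturality W W' g := ?_ }, ?_⟩⟩
    · ext W a
      exact (preadditiveCoyoneda_app_apply η a).trans
        ((congrArg _ H).trans (preadditiveCoyoneda_app_apply η' a).symm)
    · exact ConcreteCategory.congr_hom (F.map_add (f := a) (g := b)) x
    · ext a
      exact ConcreteCategory.congr_hom (F.map_comp (X := Z.unop) a g) x
    · exact ConcreteCategory.congr_hom (F.map_id Z.unop) x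

variable (C) in
/-- The functor sending an object of `C` to its representable right module. -/
abbrev rightRepFunctor : C ⥤ FpRight C := (isFpRight C).lift preadditiveYoneda isFpRight_yoneda

variable (C) in
/-- The functor sending an object of `C` to its representable left module. -/
abbrev leftRepFunctor : Cᵒᵖ ⥤ FpLeft C :=
  (isFpLeft C).lift preadditiveCoyoneda fun X => isFpLeft_coyoneda X.unop

instance : (preadditiveYoneda (C := C)).Additive where
  map_add {X Y f g} := by
    ext Z a
    exact Preadditive.comp_add _ _ _ (show Z.unop ⟶ X from a) f g

instance : (preadditiveCoyoneda (C := C)).Additive where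
  map_add {X Y f g} := by
    ext Z a
    exact Preadditive.add_comp _ _ _ f.unop g.unop (show X.unop ⟶ Z from a)

instance (F : FpRight C) : F.obj.Additive := F.property.1

instance (F : FpLeft C) : F.obj.Additive := F.property.1

instance : IsPresentationFunctor (rightRepFunctor C) :=
  (rightUniversalElements C).isPresentationFunctor _ fun _ => Iff.rfl

instance : IsPresentationFunctor (leftRepFunctor C) :=
  (leftUniversalElements C).isPresentationFunctor _ fun _ =>
    and_congr_right fun _ =>
      ⟨fun ⟨X, Y, f, p, hp⟩ => ⟨op Y, op X, f.op, p, hp⟩,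
        fun ⟨X, Y, f, p, hp⟩ => ⟨Y.unop, X.unop, f.unop, p, hp⟩⟩

lemma rightPresents_iff {X Y : C} {f : X ⟶ Y} {F : FpRight C} :
    RightPresents f F.obj ↔
      ∃ p : (rightRepFunctor C).obj Y ⟶ F, Presents (rightRepFunctor C) f p :=
  ⟨fun ⟨p, hp⟩ => ⟨ObjectProperty.homMk p,
      ((rightUniversalElements C).presents_iff _ f _).2 hp⟩,
    fun ⟨p, hp⟩ => ⟨p.hom, ((rightUniversalElements C).presents_iff _ f _).1 hp⟩⟩

lemma leftPresents_iff {X Y : C} {f : X ⟶ Y} {F : FpLeft C} :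
    LeftPresents f F.obj ↔
      ∃ p : (leftRepFunctor C).obj (op X) ⟶ F, Presents (leftRepFunctor C) f.op p :=
  ⟨fun ⟨p, hp⟩ => ⟨ObjectProperty.homMk p,
      ((leftUniversalElements C).presents_iff _ f.op _).2 hp⟩,
    fun ⟨p, hp⟩ => ⟨p.hom, ((leftUniversalElements C).presents_iff _ f.op _).1 hp⟩⟩

end Modules

section DoubleOpposite

universe v₁ u₁ v₂ u₂

variable {D : Type u₁} [Category.{v₁} D] {A : Type u₂} [Category.{v₂} A] [Preadditive A] {h : D ⥤ A}

lemma presents_unopUnop_comp_iff {X Y : Dᵒᵖᵒᵖ} {f : X ⟶ Y} {F : A}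
    {p : h.obj Y.unop.unop ⟶ F} :
    Presents (unopUnop D ⋙ h) f p ↔ Presents h f.unop.unop p := by
  have exists_comp_iff {Z : D} (a : Z ⟶ Y.unop.unop) :
      (∃ b : op (op Z) ⟶ X, b ≫ f = a.op.op) ↔ ∃ b : Z ⟶ X.unop.unop, b ≫ f.unop.unop = a :=
    ⟨fun ⟨b, hb⟩ => ⟨b.unop.unop, congrArg (fun t => t.unop.unop) hb⟩,
      fun ⟨b, hb⟩ => ⟨b.op.op, congrArg (fun t => t.op.op) hb⟩⟩
  constructor
  · refine fun hp => ⟨fun a => (hp.comp_eq_zero_iff a.op.op).trans (exists_comp_iff a), fun x => ?_⟩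
    obtain ⟨a, ha⟩ := hp.exists_lift (Z := op (op _)) x
    exact ⟨a.unop.unop, ha⟩
  · refine fun hp =>
      ⟨fun a => (hp.comp_eq_zero_iff a.unop.unop).trans (exists_comp_iff _).symm, fun x => ?_⟩
    obtain ⟨a, ha⟩ := hp.exists_lift x
    exact ⟨a.op.op, ha⟩

instance [Preadditive D] [IsPresentationFunctor h] : IsPresentationFunctor (unopUnop D ⋙ h) where
  exists_presentation F := by
    obtain ⟨X, Y, f, p, hp⟩ := IsPresentationFunctor.exists_presentation (h := h) F
    exact ⟨op (op X), op (op Y), f.op.op, p, presents_unopUnop_comp_iff.2 hp⟩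
  exists_presented f := by
    obtain ⟨F, p, hp⟩ := IsPresentationFunctor.exists_presented (h := h) f.unop.unop
    exact ⟨F, p, presents_unopUnop_comp_iff.2 hp⟩
  epi hp := (presents_unopUnop_comp_iff.1 hp).epi
  exists_desc hp := (presents_unopUnop_comp_iff.1 hp).exists_desc

end DoubleOpposite

section Transposes

variable {C : Type u} [Category.{v} C] [Preadditive C]

lemma isRightTorsionFree_iff [IsLeftCoherent C] {n : ℕ} {F : FpRight C} :
    letI := HasExt.standard (FpLeft C)
    IsRightTorsionFree n F ↔ IsTorsionFree (rightRepFunctor C) (leftRepFunctor C) n F := by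
  constructor
  · intro H X Y f p T q hp hq i hi₁ hin W
    exact H T ⟨X, Y, f, rightPresents_iff.2 ⟨p, hp⟩, leftPresents_iff.2 ⟨q, hq⟩⟩ i hi₁ hin W.unop
  · rintro H T ⟨X, Y, f, hF, hT⟩ i hi₁ hin W
    obtain ⟨p, hp⟩ := rightPresents_iff.1 hF
    obtain ⟨q, hq⟩ := leftPresents_iff.1 hT
    exact H f p T q hp hq i hi₁ hin (op W)

lemma isLeftTorsionFree_iff [IsRightCoherent C] {n : ℕ} {F : FpLeft C} :
    letI := HasExt.standard (FpRight C)
    IsLeftTorsionFree n F ↔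
      IsTorsionFree (leftRepFunctor C) (unopUnop C ⋙ rightRepFunctor C) n F := by
  constructor
  · intro H X Y f p T q hp hq i hi₁ hin W
    exact H T ⟨Y.unop, X.unop, f.unop,
      rightPresents_iff.2 ⟨q, presents_unopUnop_comp_iff.1 hq⟩, leftPresents_iff.2 ⟨p, hp⟩⟩
      i hi₁ hin W.unop.unop
  · rintro H T ⟨X, Y, f, hT, hF⟩ i hi₁ hin W
    obtain ⟨q, hq⟩ := rightPresents_iff.1 hT
    obtain ⟨p, hp⟩ := leftPresents_iff.1 hF
    exact H f.op p T q hp (presents_unopUnop_comp_iff.2 hq) i hi₁ hin (op (op W))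

variable [HasBinaryBiproducts C] [IsIdempotentComplete C] [IsRightCoherent C] [IsLeftCoherent C]

lemma forall_isRightTorsionFree_iff {n : ℕ} (hC : HasNCokernels C n) :
    (∀ F : FpRight C, projectiveDimension F ≤ 1 → IsRightTorsionFree n F) ↔
      MonosAreNKernels C n := by
  let := HasExt.standard (FpLeft C)
  simp only [monosAreNKernels_iff (rightRepFunctor C) (leftRepFunctor C) hC,
    isRightTorsionFree_iff, ← projectiveDimension_le_iff, Nat.cast_one]

lemma forall_isLeftTorsionFree_iff {n : ℕ} (hC : HasNKernels C n) :
    (∀ F : FpLeft C, projectiveDimension F ≤ 1 → IsLeftTorsionFree n F) ↔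
      MonosAreNKernels Cᵒᵖ n := by
  let := HasExt.standard (FpRight C)
  simp only [monosAreNKernels_iff (leftRepFunctor C) (unopUnop C ⋙ rightRepFunctor C)
    (hasNCokernels_op_iff.2 hC), isLeftTorsionFree_iff, ← projectiveDimension_le_iff, Nat.cast_one]

end Transposes

end NAb

theorem theorem2 {C : Type u} [Category.{v} C] [Preadditive C] [HasZeroObject C]
    [HasFiniteBiproducts C] [IsIdempotentComplete C] (n : ℕ) (hn : 1 ≤ n) :
    NAb.IsNAbelian C n ↔
      ∃ (_ : NAb.IsRightCoherent C) (_ : NAb.IsLeftCoherent C),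
        NAb.globalDimension (NAb.FpRight C) ≤ ((n + 1 : ℕ) : WithBot ℕ∞) ∧
        NAb.globalDimension (NAb.FpLeft C) ≤ ((n + 1 : ℕ) : WithBot ℕ∞) ∧
        (∀ F : NAb.FpRight C, projectiveDimension F ≤ 1 → NAb.IsRightTorsionFree n F) ∧
        (∀ F : NAb.FpLeft C, projectiveDimension F ≤ 1 → NAb.IsLeftTorsionFree n F) := by
  have := hasBinaryBiproducts_of_finite_biproducts C
  rw [NAb.isNAbelian_iff]
  constructor
  · rintro ⟨⟨hK, hK'⟩, hM, hM'⟩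
    obtain ⟨hR, hdim⟩ := (NAb.hasNKernels_iff (NAb.rightRepFunctor C) hn).1 hK
    obtain ⟨hL, hdim'⟩ := (NAb.hasNKernels_iff (NAb.leftRepFunctor C) hn).1 hK'
    exact ⟨hR, hL, hdim, hdim',
      (NAb.forall_isRightTorsionFree_iff (NAb.hasNKernels_op_iff.1 hK')).2 hM,
      (NAb.forall_isLeftTorsionFree_iff hK).2 hM'⟩
  · rintro ⟨hR, hL, hdim, hdim', hF, hF'⟩
    have hK := (NAb.hasNKernels_iff (NAb.rightRepFunctor C) hn).2 ⟨hR, hdim⟩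
    have hK' := (NAb.hasNKernels_iff (NAb.leftRepFunctor C) hn).2 ⟨hL, hdim'⟩
    exact ⟨⟨hK, hK'⟩,
      (NAb.forall_isRightTorsionFree_iff (NAb.hasNKernels_op_iff.1 hK')).1 hF,
      (NAb.forall_isLeftTorsionFree_iff hK).1 hF'⟩
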